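/- Let $P>0$ and let $W=p(y|x)$ be a memoryless channel with input alphabet $\mathbb{R}$ and an arbitrary (measurable) output alphabet $\mathcal{Y}$. All expectations below are taken under $x\sim\mathcal{N}(0,P)$, $y\sim W(\cdot|x)$, and logarithms are natural. Coding scheme. For block length $N$ and rate $R$, the codebook consists of $M=\lceil e^{NR}\rceil$ independent codewords $\underline{x}(1),\dots,\underline{x}(M)$, each $\mathcal{N}(\mathbf{0},P\mathbf{I}_N)$-distributed. Given a function $g:\mathcal{Y}\to\mathbb{R}$ and a scalar $a\in\mathbb{R}$, the decoder observing $y_1,\dots,y_N$ decides on a message $\hat m$ that minimizes $D(m)=\sum_{n=1}^N\,(g(y_n)-a\,x_n(m))^2$, with ties resolved by an arbitrary measurable rule that depends only on $(D(1),\dots,D(M))$. A rate $R$ is achievable with $(g,a)$ if the probability of decoding error, averaged over the messages and over the codebook ensemble, tends to $0$ as $N\to\infty$. We say that $I$ is the maximally achievable rate with $(g,a)$ if, for each tie-breaking rule, every $R<I$ is achievable and no $R>I$ is. GMI. For a set $A\subseteq\mathbb{R}$ of admissible scaling parameters, the generalized mutual information (GMI) of $g$ is $$\sup_{\theta<0,\;a\in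 A}\Big\{\theta\,\mathbf{E}\big[(g(y)-a x)^2\big]-\Lambda_a(\theta)\Big\},\qquad \Lambda_a(\theta)=\lim_{N\to\infty}\frac1N\log \mathbf{E}\Big[e^{\theta\sum_{n=1}^N(g(y_n)-a\tilde x_n)^2}\,\Big|\,y_1,\dots,y_N\Big],$$ where $y_1,y_2,\dots$ are i.i.d. channel outputs, $\tilde x_1,\tilde x_2,\dots$ are i.i.d. $\mathcal{N}(0,P)$ and independent of them, and the limit is a non-random constant, almost surely. Let a training data set $\mathcal{T}\in(\mathbb{R}\times\mathcal{Y})^L$ and a learning algorithm be given; the learnt quantities are held fixed. Suppose that the learnt function $g_\mathcal{T}$ is measurable with $\mathbf{E}[g_\mathcal{T}(y)^2]<\infty$. (A) Suppose that the algorithm learns a pair $(g_\mathcal{T},a_\mathcal{T})$ with $a_\mathcal{T}\neq0$ and $\mathbf{E}[(g_\mathcal{T}(y)-a_\mathcal{T}x)^2]\neq0$. Then the maximum $$I_{\mathrm{GMI},\mathcal{T},A}=\max_{\gamma\ge0}\left\{\frac12\log(1+\gamma)-\frac{\gamma}{2}-\frac{\gamma^2}{1+\gamma}\,\frac{\mathbf{E}[g_\mathcal{T}(y)^2]}{2a_\mathcal{T}^2P}+\gamma\,\frac{\mathbf{E}[x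 g_\mathcal{T}(y)]}{a_\mathcal{T}P}\right\}$$ exists, it is the GMI of $g_\mathcal{T}$ for $A=\{a_\mathcal{T}\}$, and it is the maximally achievable rate with $(g_\mathcal{T},a_\mathcal{T})$. (B) Suppose that the algorithm learns $g_\mathcal{T}$ only, with $\mathbf{E}[g_\mathcal{T}(y)^2]\neq0$, and let $$\Delta_{\mathcal{T},B}=\frac{(\mathbf{E}[x g_\mathcal{T}(y)])^2}{P\,\mathbf{E}[g_\mathcal{T}(y)^2]},$$ where $\Delta_{\mathcal{T},B}\ne1$. Then $$I_{\mathrm{GMI},\mathcal{T},B}=\frac12\log\frac{1}{1-\Delta_{\mathcal{T},B}}$$ is the GMI of $g_\mathcal{T}$ for $A=\mathbb{R}$ (that is, with the scaling parameter optimized). It is also the GMI for $A=\{a\}$ with $a=\mathbf{E}[x g_\mathcal{T}(y)]/P$, and the maximally achievable rate with $(g_\mathcal{T},a)$ for this $a$. -/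

import Mathlib

open MeasureTheory ProbabilityTheory Filter Topology
open scoped NNReal ENNReal

noncomputable section

namespace GMI

variable {𝒴 : Type*} [MeasurableSpace 𝒴]

/-- The joint law of channel input and output, `x ∼ 𝒩(0, P)` and `y ∼ W(· | x)`. -/
def jointLaw (P : ℝ≥0) (W : Kernel ℝ 𝒴) : Measure (ℝ × 𝒴) :=
  (gaussianReal 0 P) ⊗ₘ W

/-- The law of the channel output when the input is `𝒩(0, P)`. -/
def outputLaw (P : ℝ≥0) (W : Kernel ℝ 𝒴) : Measure 𝒴 :=
  (jointLaw P W).map Prod.snd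

/-- `E[x g(y)]` under `x ∼ 𝒩(0, P)`. -/
def corr (P : ℝ≥0) (W : Kernel ℝ 𝒴) (g : 𝒴 → ℝ) : ℝ :=
  ∫ z, z.1 * g z.2 ∂(jointLaw P W)

/-- `E[g(y)²]` under `x ∼ 𝒩(0, P)`. -/
def outPower (P : ℝ≥0) (W : Kernel ℝ 𝒴) (g : 𝒴 → ℝ) : ℝ :=
  ∫ z, g z.2 ^ 2 ∂(jointLaw P W)

/-- `E[(g(y) - a x)²]` under `x ∼ 𝒩(0, P)`. -/
def distortion (P : ℝ≥0) (W : Kernel ℝ 𝒴) (g : 𝒴 → ℝ) (a : ℝ) : ℝ :=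
  ∫ z, (g z.2 - a * z.1) ^ 2 ∂(jointLaw P W)

/-! ### The coding scheme -/

/-- The number of messages `M = ⌈e^{NR}⌉`. -/
def numMessages (N : ℕ) (R : ℝ) : ℕ := ⌈Real.exp (N * R)⌉₊

instance (N : ℕ) (R : ℝ) : NeZero (numMessages N R) :=
  ⟨(Nat.ceil_pos.mpr (Real.exp_pos _)).ne'⟩

/-- The law of the i.i.d. Gaussian codebook: `M` independent codewords, each
`𝒩(0, P I_N)`-distributed. -/
def codebookLaw (P : ℝ≥0) (N M : ℕ) : Measure (Fin M → Fin N → ℝ) :=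
  Measure.pi fun _ => Measure.pi fun _ => gaussianReal 0 P

/-- The law of the output block of the memoryless channel `W` for the input block `x`. -/
def channelLaw (W : Kernel ℝ 𝒴) {N : ℕ} (x : Fin N → ℝ) : Measure (Fin N → 𝒴) :=
  Measure.pi fun n => W (x n)

/-- The decoding metric `∑ₙ (g(yₙ) - a xₙ)²` of a codeword `x` for an output block `y`. -/
def metric (g : 𝒴 → ℝ) (a : ℝ) {N : ℕ} (y : Fin N → 𝒴) (x : Fin N → ℝ) : ℝ :=
  ∑ n, (g (y n) - a * x n) ^ 2

/-- `dec` picks, from the metrics of the `M` messages, a message whose metric is minimal. How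
ties are resolved is left open. -/
structure IsArgminRule (dec : ∀ (M : ℕ) [NeZero M], (Fin M → ℝ) → Fin M) : Prop where
  measurable : ∀ (M : ℕ) [NeZero M], Measurable (dec M)
  le : ∀ (M : ℕ) [NeZero M] (D : Fin M → ℝ) (m : Fin M), D (dec M D) ≤ D m

/-- The probability of decoding error, averaged over the `M` messages and over the codebook
ensemble. -/
def avgError (dec : ∀ (M : ℕ) [NeZero M], (Fin M → ℝ) → Fin M) (P : ℝ≥0) (W : Kernel ℝ 𝒴)
    (g : 𝒴 → ℝ) (a : ℝ) (N M : ℕ) [NeZero M] : ℝ≥0∞ :=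
  (M : ℝ≥0∞)⁻¹ * ∑ m : Fin M, ∫⁻ c,
    channelLaw W (c m) {y | dec M (fun m' => metric g a y (c m')) ≠ m} ∂(codebookLaw P N M)

/-- At rate `R` (nats per channel use) the average probability of decoding error vanishes as the
codeword length grows. -/
def Achievable (dec : ∀ (M : ℕ) [NeZero M], (Fin M → ℝ) → Fin M) (P : ℝ≥0) (W : Kernel ℝ 𝒴)
    (g : 𝒴 → ℝ) (a R : ℝ) : Prop :=
  Tendsto (fun N : ℕ => avgError dec P W g a N (numMessages N R)) atTop (𝓝 0)

/-- `I` is the maximally achievable rate of the i.i.d. Gaussian ensemble under nearest neighbor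
decoding with processing function `g` and scaling parameter `a`: all rates below `I` are
achievable and no rate above `I` is. -/
def IsMaxRate (P : ℝ≥0) (W : Kernel ℝ 𝒴) (g : 𝒴 → ℝ) (a I : ℝ) : Prop :=
  ∀ dec : ∀ (M : ℕ) [NeZero M], (Fin M → ℝ) → Fin M, IsArgminRule dec →
    (∀ R < I, Achievable dec P W g a R) ∧ (∀ R > I, ¬ Achievable dec P W g a R)

/-! ### The generalized mutual information -/

/-- `Λ_N(Nθ) = log E[exp(θ ∑ₙ (g(yₙ) - a xₙ)²) | y]`, for a codeword `x ∼ 𝒩(0, P I_N)` which is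
independent of the output sequence `y`. -/
def logMGF (P : ℝ≥0) (g : 𝒴 → ℝ) (a θ : ℝ) (y : ℕ → 𝒴) (N : ℕ) : ℝ :=
  Real.log (∫ x, Real.exp (θ * metric g a (fun n : Fin N => y n) x)
    ∂(Measure.pi fun _ : Fin N => gaussianReal 0 P))

/-- `I` is the generalized mutual information
`sup {θ E[(g(y) - a x)²] - Λ(θ) : θ < 0, a ∈ A}` for the processing function `g` when the scaling
parameter ranges over `A`. Here `Λ(θ) = lim Λ_N(Nθ) / N`, a limit that exists for almost every
output sequence. -/
def IsGMI (P : ℝ≥0) (W : Kernel ℝ 𝒴) (g : 𝒴 → ℝ) (A : Set ℝ) (I : ℝ) : Prop :=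
  ∃ Λ : ℝ → ℝ → ℝ,
    (∀ a ∈ A, ∀ θ < 0, ∀ᵐ y ∂(Measure.infinitePi fun _ : ℕ => outputLaw P W),
      Tendsto (fun N : ℕ => logMGF P g a θ y N / N) atTop (𝓝 (Λ a θ))) ∧
    IsLUB {v | ∃ a ∈ A, ∃ θ < 0, v = θ * distortion P W g a - Λ a θ} I

/-- The objective that is maximized over `γ ≥ 0` when the scaling parameter `a` is fixed. -/
def objective (P : ℝ≥0) (W : Kernel ℝ 𝒴) (g : 𝒴 → ℝ) (a γ : ℝ) : ℝ :=
  1 / 2 * Real.log (1 + γ) - γ / 2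
    - γ ^ 2 / (1 + γ) * (outPower P W g / (2 * a ^ 2 * P))
    + γ * (corr P W g / (a * P))

/-- `Δ = (E[x g(y)])² / (P E[g(y)²])`. -/
def Delta (P : ℝ≥0) (W : Kernel ℝ 𝒴) (g : 𝒴 → ℝ) : ℝ :=
  corr P W g ^ 2 / (P * outPower P W g)

end GMI

end

/-! Fix a message and condition on the block `z` of its inputs and outputs. The other `M - 1`
codewords are independent of `z` and of each other, so a single tail probability decides everything:
the chance that an independent Gaussian codeword has a metric below the transmitted one. The union
bound, with ties counted as errors, gives an upper bound on the error probability; requiring that no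
competitor wins strictly gives a lower bound. The tie-breaking rule enters neither.

By the strong law the transmitted metric grows like `N` times the distortion `D`. The conditional
cumulant of a competitor's metric is an explicit Gaussian integral depending on the outputs only
through `∑ g(yₙ)²`, so after division by `N` it converges almost surely to `Λ = limitCumulant`. The
Chernoff bound makes every rate below `θ D - Λ θ` achievable for each `θ ≤ 0` (`achievable_of_lt`).
Conversely, a Gärtner-Ellis lower bound (`eventually_exp_le_measureReal_lt`) excludes every rate
above `θ m - Λ θ` whenever `θ < 0` and `m = Λ' θ < D` (`not_achievable_of_gt`).

With `γ = -2 θ a² P` the function `θ D - Λ θ` becomes the concave objective, whose derivative is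
`-(D - Λ' θ) / (2 a² P)`. At its maximizer over `γ ≥ 0` either `Λ' θ = D` or `θ = 0`, so the two
bounds meet (`IsOptimal.isMaxRate`). For a free scaling parameter, `log x ≤ x - 1` leaves minus a
perfect square (`rate_le_of_neg`), and `a = E[x g(y)] / P` attains the bound. If that `a` is `0`,
all metrics tie and the rate is `0`; this case is treated directly. -/

namespace GMI

variable {𝒴 : Type*} [MeasurableSpace 𝒴]

/-! ### The law of an input-output block -/

instance (P : ℝ≥0) (W : Kernel ℝ 𝒴) [IsMarkovKernel W] : IsProbabilityMeasure (jointLaw P W) := by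
  unfold jointLaw; infer_instance

instance (P : ℝ≥0) (W : Kernel ℝ 𝒴) [IsMarkovKernel W] :
    IsProbabilityMeasure (outputLaw P W) := by
  unfold outputLaw; exact Measure.isProbabilityMeasure_map measurable_snd.aemeasurable

instance (W : Kernel ℝ 𝒴) [IsMarkovKernel W] {N : ℕ} (x : Fin N → ℝ) :
    IsProbabilityMeasure (channelLaw W x) := by
  unfold channelLaw; infer_instance

instance (P : ℝ≥0) (N M : ℕ) : IsProbabilityMeasure (codebookLaw P N M) := by
  unfold codebookLaw; infer_instance

theorem measurable_channelLaw (W : Kernel ℝ 𝒴) [IsMarkovKernel W] (N : ℕ) :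
    Measurable (fun x : Fin N → ℝ => channelLaw W x) := by
  refine Measurable.measure_of_isPiSystem_of_isProbabilityMeasure generateFrom_pi.symm
    isPiSystem_pi ?_
  rintro _ ⟨s, hs, rfl⟩
  simp only [channelLaw, Measure.pi_pi]
  refine Finset.measurable_prod _ fun n _ => ?_
  exact (W.measurable_coe (hs n (Set.mem_univ n))).comp (measurable_pi_apply n)

/-- The memoryless channel `W`, used `N` times, as a kernel between blocks. -/
noncomputable def channelKernel (W : Kernel ℝ 𝒴) [IsMarkovKernel W] (N : ℕ) :
    Kernel (Fin N → ℝ) (Fin N → 𝒴) :=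
  ⟨fun x => channelLaw W x, measurable_channelLaw W N⟩

theorem channelKernel_apply (W : Kernel ℝ 𝒴) [IsMarkovKernel W] {N : ℕ} (x : Fin N → ℝ) :
    channelKernel W N x = channelLaw W x := rfl

instance (W : Kernel ℝ 𝒴) [IsMarkovKernel W] (N : ℕ) : IsMarkovKernel (channelKernel W N) :=
  ⟨fun x => by rw [channelKernel_apply]; infer_instance⟩

theorem lintegral_fintype_prod_eq_prod {ι : Type*} [Fintype ι] {E : Type*} [MeasurableSpace E]
    (μ : Measure E) [IsProbabilityMeasure μ] (f : ι → E → ℝ≥0∞) (hf : ∀ i, Measurable (f i)) :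
    ∫⁻ x, ∏ i, f i (x i) ∂(Measure.pi fun _ : ι => μ) = ∏ i, ∫⁻ x, f i x ∂μ := by
  have h := lintegral_prod_eq_prod_lintegral_of_indepFun (μ := Measure.pi fun _ : ι => μ)
    Finset.univ (fun i x => f i (x i)) (iIndepFun_pi fun i => (hf i).aemeasurable)
    (fun i => (hf i).comp (measurable_pi_apply i))
  rw [h]
  refine Finset.prod_congr rfl fun i _ => ?_
  exact (measurePreserving_eval (fun _ : ι => μ) i).lintegral_comp (hf i)

/-- Transmitting an i.i.d. Gaussian block over the memoryless channel yields i.i.d. pairs. -/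
theorem map_compProd_channelKernel (P : ℝ≥0) (W : Kernel ℝ 𝒴) [IsMarkovKernel W] (N : ℕ) :
    ((Measure.pi fun _ : Fin N => gaussianReal 0 P) ⊗ₘ channelKernel W N).map
      (fun p n => (p.1 n, p.2 n)) = Measure.pi fun _ : Fin N => jointLaw P W := by
  have hm : Measurable (fun (p : (Fin N → ℝ) × (Fin N → 𝒴)) (n : Fin N) => (p.1 n, p.2 n)) := by
    fun_prop
  refine (Measure.pi_eq fun s hs => ?_).symm
  rw [Measure.map_apply hm (MeasurableSet.univ_pi hs),
    Measure.compProd_apply (hm (MeasurableSet.univ_pi hs))]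
  have h : ∀ x : Fin N → ℝ, channelKernel W N x (Prod.mk x ⁻¹'
      ((fun (p : (Fin N → ℝ) × (Fin N → 𝒴)) (n : Fin N) => (p.1 n, p.2 n)) ⁻¹'
        Set.univ.pi s)) = ∏ n, W (x n) (Prod.mk (x n) ⁻¹' s n) := by
    intro x
    rw [channelKernel_apply, channelLaw, ← Measure.pi_pi]
    congr 1
  simp_rw [h]
  rw [lintegral_fintype_prod_eq_prod (gaussianReal 0 P)
    (fun n x => W x (Prod.mk x ⁻¹' s n)) fun n => Kernel.measurable_kernel_prodMk_left (hs n)]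
  refine Finset.prod_congr rfl fun n _ => ?_
  rw [jointLaw, Measure.compProd_apply (hs n)]

theorem lintegral_channelLaw (P : ℝ≥0) (W : Kernel ℝ 𝒴) [IsMarkovKernel W] (N : ℕ)
    {f : (Fin N → ℝ × 𝒴) → ℝ≥0∞} (hf : Measurable f) :
    ∫⁻ x, ∫⁻ y, f (fun n => (x n, y n)) ∂(channelLaw W x)
      ∂(Measure.pi fun _ : Fin N => gaussianReal 0 P) =
    ∫⁻ z, f z ∂(Measure.pi fun _ : Fin N => jointLaw P W) := by
  have hm : Measurable (fun (p : (Fin N → ℝ) × (Fin N → 𝒴)) (n : Fin N) => (p.1 n, p.2 n)) := by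
    fun_prop
  rw [← map_compProd_channelKernel, lintegral_map hf hm]
  exact (Measure.lintegral_compProd (κ := channelKernel W N) (hf.comp hm)).symm

/-- The first `N` entries of an i.i.d. sequence. -/
theorem map_infinitePi_fin {E : Type*} [MeasurableSpace E] (μ : Measure E)
    [IsProbabilityMeasure μ] (N : ℕ) :
    (Measure.infinitePi fun _ : ℕ => μ).map (fun ω (n : Fin N) => ω n) =
      Measure.pi fun _ : Fin N => μ := by
  rw [← Measure.infinitePi_eq_pi]
  exact Measure.map_infinitePi_infinitePi_of_inj (P := fun _ : ℕ => μ) Fin.val_injective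

/-- This places all block lengths on one probability space, so that almost sure limits and dominated
convergence become available for the error probabilities. -/
theorem lintegral_infinitePi_fin {E : Type*} [MeasurableSpace E] (μ : Measure E)
    [IsProbabilityMeasure μ] (N : ℕ) {f : (Fin N → E) → ℝ≥0∞} (hf : Measurable f) :
    ∫⁻ ω, f (fun n => ω n) ∂(Measure.infinitePi fun _ : ℕ => μ) =
      ∫⁻ z, f z ∂(Measure.pi fun _ : Fin N => μ) := by
  rw [← map_infinitePi_fin, lintegral_map hf (by fun_prop)]

theorem ae_tendsto_average {E : Type*} [MeasurableSpace E] (μ : Measure E)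
    [IsProbabilityMeasure μ] {f : E → ℝ} (hf : Measurable f) (hi : Integrable f μ) :
    ∀ᵐ ω ∂(Measure.infinitePi fun _ : ℕ => μ),
      Tendsto (fun N : ℕ => (∑ n : Fin N, f (ω n)) / N) atTop (𝓝 (∫ z, f z ∂μ)) := by
  have hmp : ∀ i, MeasurePreserving (fun ω : ℕ → E => ω i)
      (Measure.infinitePi fun _ : ℕ => μ) μ := fun i =>
    measurePreserving_eval_infinitePi (fun _ : ℕ => μ) i
  have h := strong_law_ae_real (μ := Measure.infinitePi fun _ : ℕ => μ)
    (fun i ω => f (ω i)) ((hmp 0).integrable_comp_of_integrable hi)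
    (fun i j hij => (iIndepFun_infinitePi (P := fun _ : ℕ => μ) (X := fun _ => f)
      fun _ => hf).indepFun hij)
    (fun i => by
      refine ⟨(hf.comp (measurable_pi_apply i)).aemeasurable,
        (hf.comp (measurable_pi_apply 0)).aemeasurable, ?_⟩
      have e : ∀ i, Measure.map (fun ω : ℕ → E => f (ω i))
          (Measure.infinitePi fun _ : ℕ => μ) = μ.map f := fun i => by
        rw [← (hmp i).map_eq, Measure.map_map hf (hmp i).measurable, (hmp i).map_eq]; rfl
      rw [e, e])
  have hint : ∫ ω, f (ω 0) ∂(Measure.infinitePi fun _ : ℕ => μ) = ∫ z, f z ∂μ := by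
    have e := integral_map (μ := Measure.infinitePi fun _ : ℕ => μ)
      (hmp 0).measurable.aemeasurable (f := f) (by rw [(hmp 0).map_eq]; exact hi.1)
    rw [(hmp 0).map_eq] at e
    exact e.symm
  filter_upwards [h] with ω hω
  rw [hint] at hω
  simpa only [Finset.sum_range] using hω

/-! ### The error probability as an expectation over an i.i.d. sequence of pairs -/

theorem measurable_metric {g : 𝒴 → ℝ} (hg : Measurable g) (a : ℝ) (N : ℕ) :
    Measurable (fun p : (Fin N → 𝒴) × (Fin N → ℝ) => metric g a p.1 p.2) := by
  unfold metric
  fun_prop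

/-- The metric of the transmitted codeword, for a block of input-output pairs. -/
noncomputable def trueMetric (g : 𝒴 → ℝ) (a : ℝ) {N : ℕ} (z : Fin N → ℝ × 𝒴) : ℝ :=
  metric g a (fun n => (z n).2) fun n => (z n).1

theorem measurable_trueMetric {g : 𝒴 → ℝ} (hg : Measurable g) (a : ℝ) (N : ℕ) :
    Measurable (fun z : Fin N → ℝ × 𝒴 => trueMetric g a z) := by
  unfold trueMetric metric
  fun_prop

/-- The metrics of all `n + 1` messages when message `m` is sent, the block of its inputs and
outputs is `z`, and `c` are the codewords of the other messages. -/
noncomputable def allMetrics (g : 𝒴 → ℝ) (a : ℝ) {N n : ℕ} (m : Fin (n + 1))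
    (z : Fin N → ℝ × 𝒴) (c : Fin n → Fin N → ℝ) : Fin (n + 1) → ℝ :=
  m.insertNth (α := fun _ => ℝ) (trueMetric g a z) fun i => metric g a (fun k => (z k).2) (c i)

theorem measurable_allMetrics {g : 𝒴 → ℝ} (hg : Measurable g) (a : ℝ) {N n : ℕ}
    (m : Fin (n + 1)) :
    Measurable (fun p : (Fin N → ℝ × 𝒴) × (Fin n → Fin N → ℝ) => allMetrics g a m p.1 p.2) := by
  refine measurable_pi_iff.2 (m.forall_iff_succAbove.2 ⟨?_, fun i => ?_⟩)
  · simp only [allMetrics, Fin.insertNth_apply_same]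
    exact (measurable_trueMetric hg a N).comp measurable_fst
  · simp only [allMetrics, Fin.insertNth_apply_succAbove]
    exact (measurable_metric hg a N).comp
      (f := fun p : (Fin N → ℝ × 𝒴) × (Fin n → Fin N → ℝ) => ((fun k => (p.1 k).2), p.2 i))
      (by fun_prop)

/-- Codeword `m` is split off from the codebook and, by Tonelli, the integrals over the output and
over the remaining codewords are exchanged. Codeword and output then merge into an i.i.d. block of
pairs, independent of the competitors. -/
theorem lintegral_error_eq {dec : ∀ (M : ℕ) [NeZero M], (Fin M → ℝ) → Fin M}
    (hdec : IsArgminRule dec) (P : ℝ≥0) (W : Kernel ℝ 𝒴) [IsMarkovKernel W] {g : 𝒴 → ℝ}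
    (hg : Measurable g) (a : ℝ) (N n : ℕ) [NeZero (n + 1)] (m : Fin (n + 1)) :
    ∫⁻ c, channelLaw W (c m) {y | dec (n + 1) (fun m' => metric g a y (c m')) ≠ m}
      ∂(codebookLaw P N (n + 1)) =
    ∫⁻ z, codebookLaw P N n {c | dec (n + 1) (allMetrics g a m z c) ≠ m}
      ∂(Measure.pi fun _ : Fin N => jointLaw P W) := by
  set S : Set ((Fin N → ℝ × 𝒴) × (Fin n → Fin N → ℝ)) :=
    {p | dec (n + 1) (allMetrics g a m p.1 p.2) ≠ m} with hS
  have hSm : MeasurableSet S :=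
    ((hdec.measurable (n + 1)).comp (measurable_allMetrics hg a m))
      (MeasurableSet.singleton m).compl
  have hpair : Measurable fun q : ((Fin N → ℝ) × (Fin n → Fin N → ℝ)) × (Fin N → 𝒴) =>
      ((fun k => (q.1.1 k, q.2 k) : Fin N → ℝ × 𝒴), q.1.2) := by fun_prop
  have hset : ∀ (c : Fin (n + 1) → Fin N → ℝ),
      {y | dec (n + 1) (fun m' => metric g a y (c m')) ≠ m} =
        {y | ((fun k => (c m k, y k) : Fin N → ℝ × 𝒴), fun i => c (m.succAbove i)) ∈ S} := by
    intro c
    ext y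
    have : (fun m' => metric g a y (c m')) = allMetrics g a m
        (fun k => (c m k, y k) : Fin N → ℝ × 𝒴) (fun i => c (m.succAbove i)) := by
      funext m'
      induction m' using m.succAboveCases with
      | x => simp [allMetrics, trueMetric]
      | p i => simp [allMetrics]
    simp only [Set.mem_ofPred_eq, hS, this]
  let F : (Fin N → ℝ) × (Fin n → Fin N → ℝ) → ℝ≥0∞ := fun p =>
    channelLaw W p.1 {y | ((fun k => (p.1 k, y k) : Fin N → ℝ × 𝒴), p.2) ∈ S}
  have hF : Measurable F := by
    have := Kernel.measurable_kernel_prodMk_left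
      (κ := (channelKernel W N).comap (Prod.fst : (Fin N → ℝ) × (Fin n → Fin N → ℝ) → _)
        measurable_fst) (hpair hSm)
    exact this
  calc
    _ = ∫⁻ c, F (MeasurableEquiv.piFinSuccAbove (fun _ => Fin N → ℝ) m c)
        ∂(codebookLaw P N (n + 1)) := by
      refine lintegral_congr fun c => ?_
      rw [hset]
      rfl
    _ = ∫⁻ p, F p ∂((Measure.pi fun _ : Fin N => gaussianReal 0 P).prod
          (codebookLaw P N n)) :=
      (measurePreserving_piFinSuccAbove
        (fun _ : Fin (n + 1) => Measure.pi fun _ : Fin N => gaussianReal 0 P) m).lintegral_comp hF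
    _ = ∫⁻ x, ∫⁻ c, F (x, c) ∂(codebookLaw P N n)
          ∂(Measure.pi fun _ : Fin N => gaussianReal 0 P) := lintegral_prod _ hF.aemeasurable
    _ = ∫⁻ x, ∫⁻ y, codebookLaw P N n (Prod.mk (fun k => (x k, y k)) ⁻¹' S) ∂(channelLaw W x)
          ∂(Measure.pi fun _ : Fin N => gaussianReal 0 P) := by
      refine lintegral_congr fun x => ?_
      have hT : MeasurableSet {q : (Fin n → Fin N → ℝ) × (Fin N → 𝒴) |
          ((fun k => (x k, q.2 k) : Fin N → ℝ × 𝒴), q.1) ∈ S} := by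
        refine (Measurable.prodMk ?_ measurable_fst) hSm
        fun_prop
      exact (Measure.prod_apply (μ := codebookLaw P N n) (ν := channelLaw W x) hT).symm.trans
        (Measure.prod_apply_symm hT)
    _ = _ := lintegral_channelLaw P W N (measurable_measure_prodMk_left hSm)

/-- The probability that an independent codeword beats, or ties with, the transmitted one. -/
noncomputable def leProb (P : ℝ≥0) (g : 𝒴 → ℝ) (a : ℝ) {N : ℕ} (z : Fin N → ℝ × 𝒴) : ℝ≥0∞ :=
  (Measure.pi fun _ : Fin N => gaussianReal 0 P)
    {x | metric g a (fun n => (z n).2) x ≤ trueMetric g a z}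

/-- The probability that an independent codeword does not strictly beat the transmitted one. -/
noncomputable def geProb (P : ℝ≥0) (g : 𝒴 → ℝ) (a : ℝ) {N : ℕ} (z : Fin N → ℝ × 𝒴) : ℝ≥0∞ :=
  (Measure.pi fun _ : Fin N => gaussianReal 0 P)
    {x | trueMetric g a z ≤ metric g a (fun n => (z n).2) x}

theorem measurable_leProb (P : ℝ≥0) {g : 𝒴 → ℝ} (hg : Measurable g) (a : ℝ) (N : ℕ) :
    Measurable (fun z : Fin N → ℝ × 𝒴 => leProb P g a z) := by
  refine measurable_measure_prodMk_left (s := {p : (Fin N → ℝ × 𝒴) × (Fin N → ℝ) |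
    metric g a (fun n => (p.1 n).2) p.2 ≤ trueMetric g a p.1}) (measurableSet_le ?_ ?_)
  · exact (measurable_metric hg a N).comp
      (f := fun p : (Fin N → ℝ × 𝒴) × (Fin N → ℝ) => ((fun k => (p.1 k).2), p.2)) (by fun_prop)
  · exact (measurable_trueMetric hg a N).comp measurable_fst

theorem measurable_geProb (P : ℝ≥0) {g : 𝒴 → ℝ} (hg : Measurable g) (a : ℝ) (N : ℕ) :
    Measurable (fun z : Fin N → ℝ × 𝒴 => geProb P g a z) := by
  refine measurable_measure_prodMk_left (s := {p : (Fin N → ℝ × 𝒴) × (Fin N → ℝ) |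
    trueMetric g a p.1 ≤ metric g a (fun n => (p.1 n).2) p.2}) (measurableSet_le ?_ ?_)
  · exact (measurable_trueMetric hg a N).comp measurable_fst
  · exact (measurable_metric hg a N).comp
      (f := fun p : (Fin N → ℝ × 𝒴) × (Fin N → ℝ) => ((fun k => (p.1 k).2), p.2)) (by fun_prop)

/-- Union bound: a wrong decision requires some competitor with a metric at most the transmitted
one, whatever the rule for ties. -/
theorem codebookLaw_error_le {𝒴 : Type*}
    {dec : ∀ (M : ℕ) [NeZero M], (Fin M → ℝ) → Fin M}
    (hdec : IsArgminRule dec) (P : ℝ≥0) (g : 𝒴 → ℝ) (a : ℝ) {N n : ℕ} [NeZero (n + 1)]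
    (m : Fin (n + 1)) (z : Fin N → ℝ × 𝒴) :
    codebookLaw P N n {c | dec (n + 1) (allMetrics g a m z c) ≠ m} ≤ n * leProb P g a z := by
  have hsub : {c | dec (n + 1) (allMetrics g a m z c) ≠ m} ⊆
      ⋃ i : Fin n, (fun c : Fin n → Fin N → ℝ => c i) ⁻¹'
        {x | metric g a (fun k => (z k).2) x ≤ trueMetric g a z} := by
    intro c hc
    obtain ⟨i, hi⟩ := Fin.exists_succAbove_eq (y := m) hc
    have h := hdec.le (n + 1) (allMetrics g a m z c) m
    rw [← hi] at h
    simp only [allMetrics, Fin.insertNth_apply_succAbove, Fin.insertNth_apply_same] at h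
    exact Set.mem_iUnion.2 ⟨i, h⟩
  refine (measure_mono hsub).trans ((measure_iUnion_le _).trans ?_)
  rw [tsum_fintype]
  refine (Finset.sum_le_card_nsmul _ _ (leProb P g a z) fun i _ => ?_).trans (by simp)
  refine (Measure.le_map_apply (measurable_pi_apply i).aemeasurable _).trans ?_
  rw [codebookLaw, (measurePreserving_eval
    (fun _ : Fin n => Measure.pi fun _ : Fin N => gaussianReal 0 P) i).map_eq, leProb]

/-- A correct decision forces all `n` competitors to have at least the transmitted metric, and these
events are independent given `z`. The additive form avoids truncated subtraction. -/
theorem one_le_codebookLaw_error_add {𝒴 : Type*}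
    {dec : ∀ (M : ℕ) [NeZero M], (Fin M → ℝ) → Fin M}
    (hdec : IsArgminRule dec) (P : ℝ≥0) (g : 𝒴 → ℝ) (a : ℝ) {N n : ℕ} [NeZero (n + 1)]
    (m : Fin (n + 1)) (z : Fin N → ℝ × 𝒴) :
    1 ≤ codebookLaw P N n {c | dec (n + 1) (allMetrics g a m z c) ≠ m} +
      geProb P g a z ^ n := by
  have hbox : codebookLaw P N n (Set.univ.pi fun _ : Fin n =>
      {x | trueMetric g a z ≤ metric g a (fun k => (z k).2) x}) = geProb P g a z ^ n := by
    rw [codebookLaw, Measure.pi_pi]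
    simp [geProb]
  rw [← hbox, ← measure_univ (μ := codebookLaw P N n)]
  refine (measure_mono fun c _ => ?_).trans (measure_union_le _ _)
  by_cases hc : dec (n + 1) (allMetrics g a m z c) = m
  · right
    intro i _
    have h := hdec.le (n + 1) (allMetrics g a m z c) (m.succAbove i)
    rw [hc] at h
    simp only [allMetrics, Fin.insertNth_apply_succAbove, Fin.insertNth_apply_same] at h
    exact h
  · exact Or.inl hc

theorem inv_mul_sum_const {M : ℕ} [NeZero M] (b : ℝ≥0∞) :
    (M : ℝ≥0∞)⁻¹ * ∑ _m : Fin M, b = b := by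
  rw [Finset.sum_const, Finset.card_univ, Fintype.card_fin, nsmul_eq_mul, ← mul_assoc,
    ENNReal.inv_mul_cancel (by exact_mod_cast NeZero.ne M) (ENNReal.natCast_ne_top M), one_mul]

theorem avgError_le {dec : ∀ (M : ℕ) [NeZero M], (Fin M → ℝ) → Fin M}
    (hdec : IsArgminRule dec) (P : ℝ≥0) (W : Kernel ℝ 𝒴) [IsMarkovKernel W] {g : 𝒴 → ℝ}
    (hg : Measurable g) (a : ℝ) (N M : ℕ) [NeZero M] :
    avgError dec P W g a N M ≤
      ∫⁻ ω, min 1 (((M - 1 : ℕ) : ℝ≥0∞) * leProb P g a (fun n : Fin N => ω n))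
        ∂(Measure.infinitePi fun _ : ℕ => jointLaw P W) := by
  obtain ⟨n, rfl⟩ := Nat.exists_eq_succ_of_ne_zero (NeZero.ne M)
  rw [lintegral_infinitePi_fin (jointLaw P W) N
    (f := fun z => min 1 (((n + 1 - 1 : ℕ) : ℝ≥0∞) * leProb P g a z))
    (measurable_const.min ((measurable_leProb P hg a N).const_mul _)), avgError,
    ← inv_mul_sum_const (M := n + 1) (∫⁻ z, _ ∂(Measure.pi fun _ : Fin N => jointLaw P W))]
  gcongr with m _
  rw [lintegral_error_eq hdec P W hg]
  exact lintegral_mono fun z => le_min prob_le_one (codebookLaw_error_le hdec P g a m z)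

theorem one_le_avgError_add {dec : ∀ (M : ℕ) [NeZero M], (Fin M → ℝ) → Fin M}
    (hdec : IsArgminRule dec) (P : ℝ≥0) (W : Kernel ℝ 𝒴) [IsMarkovKernel W] {g : 𝒴 → ℝ}
    (hg : Measurable g) (a : ℝ) (N M : ℕ) [NeZero M] :
    1 ≤ avgError dec P W g a N M +
      ∫⁻ ω, geProb P g a (fun n : Fin N => ω n) ^ (M - 1)
        ∂(Measure.infinitePi fun _ : ℕ => jointLaw P W) := by
  obtain ⟨n, rfl⟩ := Nat.exists_eq_succ_of_ne_zero (NeZero.ne M)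
  rw [lintegral_infinitePi_fin (jointLaw P W) N (f := fun z => geProb P g a z ^ (n + 1 - 1))
    ((measurable_geProb P hg a N).pow_const _), avgError,
    ← inv_mul_sum_const (M := n + 1) (∫⁻ z, _ ∂(Measure.pi fun _ : Fin N => jointLaw P W)),
    ← mul_add, ← Finset.sum_add_distrib, ← inv_mul_sum_const (M := n + 1) 1]
  gcongr with m _
  rw [lintegral_error_eq hdec P W hg,
    ← lintegral_add_right _ ((measurable_geProb P hg a N).pow_const _)]
  calc (1 : ℝ≥0∞) = ∫⁻ _, 1 ∂(Measure.pi fun _ : Fin N => jointLaw P W) := by simp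
    _ ≤ _ := lintegral_mono fun z => one_le_codebookLaw_error_add hdec P g a m z

/-- With the scaling parameter `0` all messages tie, and guessing is as good as decoding. -/
theorem avgError_zero_scaling {dec : ∀ (M : ℕ) [NeZero M], (Fin M → ℝ) → Fin M}
    (hdec : IsArgminRule dec) (P : ℝ≥0) (W : Kernel ℝ 𝒴) [IsMarkovKernel W] {g : 𝒴 → ℝ}
    (hg : Measurable g) (N M : ℕ) [NeZero M] :
    avgError dec P W g 0 N M = (M : ℝ≥0∞)⁻¹ * (M - 1 : ℕ) := by
  obtain ⟨n, rfl⟩ := Nat.exists_eq_succ_of_ne_zero (NeZero.ne M)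
  -- The decision depends neither on the codebook nor on the message sent, so for each `z` exactly
  -- `n` of the `n + 1` messages are decoded wrongly.
  let v : (Fin N → ℝ × 𝒴) → Fin (n + 1) := fun z => dec (n + 1) fun _ => trueMetric g 0 z
  have hv : Measurable v := (hdec.measurable (n + 1)).comp
    (measurable_pi_iff.2 fun _ => measurable_trueMetric hg 0 N)
  have hall : ∀ (m : Fin (n + 1)) (z : Fin N → ℝ × 𝒴) (c : Fin n → Fin N → ℝ),
      allMetrics g 0 m z c = fun _ => trueMetric g 0 z := by
    intro m z c
    funext m'
    induction m' using m.succAboveCases with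
    | x => simp [allMetrics]
    | p i => simp [allMetrics, trueMetric, metric]
  rw [avgError]
  congr 1
  calc
    _ = ∑ m : Fin (n + 1), ∫⁻ z, (if v z ≠ m then 1 else 0)
        ∂(Measure.pi fun _ : Fin N => jointLaw P W) := by
      refine Finset.sum_congr rfl fun m _ => ?_
      rw [lintegral_error_eq hdec P W hg]
      refine lintegral_congr fun z => ?_
      simp only [hall]
      by_cases h : v z = m
      · simp [v] at h ⊢; simp [h]
      · simp [v] at h ⊢; simp [h]
    _ = ∫⁻ z, ∑ m : Fin (n + 1), (if v z ≠ m then 1 else 0)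
        ∂(Measure.pi fun _ : Fin N => jointLaw P W) :=
      (lintegral_finsetSum _ fun m _ => Measurable.ite
        (hv (MeasurableSet.singleton m).compl) measurable_const measurable_const).symm
    _ = _ := by
      have : ∀ z, ∑ m : Fin (n + 1), (if v z ≠ m then (1 : ℝ≥0∞) else 0) = (n : ℝ≥0∞) := by
        intro z
        rw [Finset.sum_ite, Finset.sum_const, Finset.sum_const_zero, Finset.filter_ne]
        simp
      simp only [this]
      simp

/-! ### Exponential moments of the metric -/

/-- Completing the square turns the integrand into a constant times the Gaussian density of mean `-2
θ a b P / u` and variance `P / u`, where `u = 1 - 2 θ a² P` is positive because `θ ≤ 0`. -/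
theorem integral_exp_sq_gaussianReal {P : ℝ≥0} (hP : 0 < P) {θ : ℝ} (hθ : θ ≤ 0) (a b : ℝ) :
    ∫ x, Real.exp (θ * (b - a * x) ^ 2) ∂(gaussianReal 0 P) =
      Real.exp (-(1 / 2) * Real.log (1 - 2 * θ * a ^ 2 * P) +
        θ * b ^ 2 / (1 - 2 * θ * a ^ 2 * P)) := by
  have hP' : (0 : ℝ) < P := hP
  set u : ℝ := 1 - 2 * θ * a ^ 2 * P with hu
  have hu0 : 0 < u := by
    have : 0 ≤ -θ * (a ^ 2 * P) := mul_nonneg (neg_nonneg.2 hθ) (by positivity)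
    nlinarith
  have hv : P / u.toNNReal ≠ 0 := (div_pos hP (Real.toNNReal_pos.2 hu0)).ne'
  have hvr : ((P / u.toNNReal : ℝ≥0) : ℝ) = P / u := by
    rw [NNReal.coe_div, Real.coe_toNNReal _ hu0.le]
  have hsq : Real.exp (-(1 / 2) * Real.log u) = (√u)⁻¹ := by
    rw [Real.sqrt_eq_rpow, ← Real.rpow_neg hu0.le, Real.rpow_def_of_pos hu0]
    ring_nf
  rw [integral_gaussianReal_eq_integral_smul hP.ne']
  have key : ∀ x : ℝ, gaussianPDFReal 0 P x • Real.exp (θ * (b - a * x) ^ 2) =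
      Real.exp (-(1 / 2) * Real.log u + θ * b ^ 2 / u) *
        gaussianPDFReal (-2 * θ * a * b * P / u) (P / u.toNNReal) x := by
    intro x
    rw [gaussianPDFReal, gaussianPDFReal, hvr, Real.exp_add, hsq, smul_eq_mul,
      show 2 * Real.pi * (P / u) = 2 * Real.pi * P / u by ring, Real.sqrt_div (by positivity),
      inv_div]
    have e : Real.exp (-(x - 0) ^ 2 / (2 * P)) * Real.exp (θ * (b - a * x) ^ 2) =
        Real.exp (θ * b ^ 2 / u) *
          Real.exp (-(x - -2 * θ * a * b * P / u) ^ 2 / (2 * (P / u))) := by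
      rw [← Real.exp_add, ← Real.exp_add]
      congr 1
      field_simp
      rw [hu]
      ring
    have hs : √u ≠ 0 := (Real.sqrt_pos.2 hu0).ne'
    rw [mul_assoc, e]
    field_simp
  simp_rw [key]
  rw [integral_const_mul, integral_gaussianPDFReal_eq_one _ hv, mul_one]

/-- The logarithm of the conditional exponential moment of the metric of an independent
codeword. -/
noncomputable def cumulant {𝒴 : Type*} (P : ℝ≥0) (g : 𝒴 → ℝ) (a : ℝ) {N : ℕ} (y : Fin N → 𝒴)
    (θ : ℝ) : ℝ :=
  N * (-(1 / 2) * Real.log (1 - 2 * θ * a ^ 2 * P)) +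
    θ * (∑ n, g (y n) ^ 2) / (1 - 2 * θ * a ^ 2 * P)

theorem integral_exp_metric {𝒴 : Type*} {P : ℝ≥0} (hP : 0 < P) {θ : ℝ} (hθ : θ ≤ 0) (a : ℝ)
    (g : 𝒴 → ℝ) {N : ℕ} (y : Fin N → 𝒴) :
    ∫ x, Real.exp (θ * metric g a y x) ∂(Measure.pi fun _ : Fin N => gaussianReal 0 P) =
      Real.exp (cumulant P g a y θ) := by
  simp_rw [metric, Finset.mul_sum, Real.exp_sum]
  rw [integral_fintype_prod_eq_prod (fun n x => Real.exp (θ * (g (y n) - a * x) ^ 2))]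
  simp_rw [integral_exp_sq_gaussianReal hP hθ]
  rw [← Real.exp_sum, cumulant]
  congr 1
  rw [Finset.sum_add_distrib, Finset.sum_const, Finset.card_univ, Fintype.card_fin,
    nsmul_eq_mul, Finset.mul_sum, Finset.sum_div]

theorem metric_nonneg {𝒴 : Type*} (g : 𝒴 → ℝ) (a : ℝ) {N : ℕ} (y : Fin N → 𝒴)
    (x : Fin N → ℝ) : 0 ≤ metric g a y x :=
  Finset.sum_nonneg fun _ _ => sq_nonneg _

theorem measurable_metric_right {𝒴 : Type*} (g : 𝒴 → ℝ) (a : ℝ) {N : ℕ} (y : Fin N → 𝒴) :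
    Measurable (metric g a y) := by
  unfold metric
  fun_prop

theorem integrable_exp_metric {𝒴 : Type*} (P : ℝ≥0) {θ : ℝ} (hθ : θ ≤ 0) (a : ℝ)
    (g : 𝒴 → ℝ) {N : ℕ} (y : Fin N → 𝒴) :
    Integrable (fun x => Real.exp (θ * metric g a y x))
      (Measure.pi fun _ : Fin N => gaussianReal 0 P) := by
  refine Integrable.of_bound (C := 1)
    ((measurable_metric_right g a y).const_mul θ).exp.aestronglyMeasurable
    (ae_of_all _ fun x => ?_)
  rw [Real.norm_eq_abs, Real.abs_exp, Real.exp_le_one_iff]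
  exact mul_nonpos_of_nonpos_of_nonneg hθ (metric_nonneg g a y x)

/-- The Chernoff bound for the metric of an independent codeword. -/
theorem measureReal_metric_le {𝒴 : Type*} {P : ℝ≥0} (hP : 0 < P) {θ : ℝ} (hθ : θ ≤ 0) (a : ℝ)
    (g : 𝒴 → ℝ) {N : ℕ} (y : Fin N → 𝒴) (t : ℝ) :
    (Measure.pi fun _ : Fin N => gaussianReal 0 P).real {x | metric g a y x ≤ t} ≤
      Real.exp (cumulant P g a y θ - θ * t) := by
  have h := measure_le_le_exp_mul_mgf
    (μ := Measure.pi fun _ : Fin N => gaussianReal 0 P) (X := metric g a y) t hθ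
    (integrable_exp_metric P hθ a g y)
  rw [mgf, integral_exp_metric hP hθ, ← Real.exp_add] at h
  exact h.trans_eq (by ring_nf)

/-! ### A large deviations lower bound from exponential moments -/

theorem tendsto_atBot_of_div_nat {c : ℕ → ℝ} {l : ℝ} (hl : l < 0)
    (h : Tendsto (fun N => c N / N) atTop (𝓝 l)) : Tendsto c atTop atBot := by
  have h1 := h.neg_mul_atTop hl (tendsto_natCast_atTop_atTop (R := ℝ))
  refine h1.congr' ?_
  filter_upwards [eventually_gt_atTop 0] with N hN
  have : (N : ℝ) ≠ 0 := by exact_mod_cast hN.ne'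
  field_simp

theorem tendsto_exp_zero_of_div_nat {c : ℕ → ℝ} {l : ℝ} (hl : l < 0)
    (h : Tendsto (fun N => c N / N) atTop (𝓝 l)) :
    Tendsto (fun N => Real.exp (c N)) atTop (𝓝 0) :=
  Real.tendsto_exp_atBot.comp (tendsto_atBot_of_div_nat hl h)

/-- Supplies the two neighbouring exponents `θ ± η` at which the parts of the moment away from `N m`
become exponentially negligible. -/
theorem exists_step_of_hasDerivAt {Λ : ℝ → ℝ} {θ m ε : ℝ} (hθ : θ < 0) (hε : 0 < ε)
    (h : HasDerivAt Λ m θ) :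
    ∃ η > 0, θ + η < 0 ∧ Λ (θ + η) - Λ θ - η * m < η * ε ∧ Λ (θ - η) - Λ θ + η * m < η * ε := by
  have h1 := hasDerivAt_iff_isLittleO_nhds_zero.1 h
  have h2 := h1.def (half_pos hε)
  obtain ⟨r, hr, hball⟩ := Metric.eventually_nhds_iff.1 h2
  refine ⟨min (r / 2) (-θ / 2), lt_min (by linarith) (by linarith), ?_, ?_, ?_⟩
  · have := min_le_right (r / 2) (-θ / 2)
    linarith
  all_goals
    set η := min (r / 2) (-θ / 2)
    have hη : 0 < η := lt_min (by linarith) (by linarith)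
    have hηr : η < r := (min_le_left _ _).trans_lt (by linarith)
  · have := hball (y := η) (by simpa [abs_of_pos hη] using hηr)
    rw [Real.norm_eq_abs, Real.norm_eq_abs, abs_of_pos hη, smul_eq_mul] at this
    nlinarith [le_abs_self (Λ (θ + η) - Λ θ - η * m)]
  · have := hball (y := -η) (by simpa [abs_of_pos hη] using hηr)
    rw [Real.norm_eq_abs, Real.norm_eq_abs, abs_neg, abs_of_pos hη, smul_eq_mul,
      ← sub_eq_add_neg] at this
    nlinarith [le_abs_self (Λ (θ - η) - Λ θ - -η * m)]

/-- The lower bound of the Gärtner-Ellis theorem for left tails: if the normalized cumulants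
converge to `Λ` on the negative axis, then the probability of `D N < t N`, where `t N / N` tends
to a limit above `Λ' θ = m`, decays at most with the exponent `θ * m - Λ θ`. -/
theorem eventually_exp_le_measureReal_lt {Ω : ℕ → Type*} [∀ N, MeasurableSpace (Ω N)]
    (μ : ∀ N, Measure (Ω N)) [∀ N, IsProbabilityMeasure (μ N)] {D : ∀ N, Ω N → ℝ}
    (hD : ∀ N, Measurable (D N)) {L : ℕ → ℝ → ℝ} {Λ : ℝ → ℝ}
    (hint : ∀ N, ∀ θ < 0, Integrable (fun x => Real.exp (θ * D N x)) (μ N))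
    (hL : ∀ N, ∀ θ < 0, ∫ x, Real.exp (θ * D N x) ∂(μ N) = Real.exp (L N θ))
    (hΛ : ∀ θ < 0, Tendsto (fun N => L N θ / N) atTop (𝓝 (Λ θ)))
    {θ m d r : ℝ} (hθ : θ < 0) (hderiv : HasDerivAt Λ m θ) (hmd : m < d) {t : ℕ → ℝ}
    (ht : Tendsto (fun N => t N / N) atTop (𝓝 d)) (hr : θ * m - Λ θ < r) :
    ∀ᶠ N : ℕ in atTop, Real.exp (-(N * r)) ≤ (μ N).real {x | D N x < t N} := by
  -- The first condition puts the cut `N (m + ε)` below `t N` eventually; the second keeps the loss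
  -- from replacing `m` by `m - ε` within the margin up to `r`.
  obtain ⟨ε, hε, hε1, hε2⟩ : ∃ ε > 0, m + ε < d ∧ -θ * ε < r - (θ * m - Λ θ) := by
    have h1 : 0 < (r - (θ * m - Λ θ)) / (-θ) := div_pos (by linarith) (by linarith)
    refine ⟨min ((d - m) / 2) ((r - (θ * m - Λ θ)) / (-θ) / 2),
      lt_min (by linarith) (by linarith), ?_, ?_⟩
    · linarith [min_le_left ((d - m) / 2) ((r - (θ * m - Λ θ)) / (-θ) / 2)]
    · have h2 := min_le_right ((d - m) / 2) ((r - (θ * m - Λ θ)) / (-θ) / 2)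
      have h3 : min ((d - m) / 2) ((r - (θ * m - Λ θ)) / (-θ) / 2) <
        (r - (θ * m - Λ θ)) / (-θ) := by linarith
      rw [lt_div_iff₀ (by linarith)] at h3
      linarith
  obtain ⟨η, hη, hηθ, hup, hlo⟩ := exists_step_of_hasDerivAt hθ hε hderiv
  have hlim : ∀ c : ℝ, Tendsto (fun N : ℕ => (N * c : ℝ) / N) atTop (𝓝 c) := fun c => by
    refine tendsto_const_nhds.congr' ?_
    filter_upwards [eventually_gt_atTop 0] with N hN
    have : (N : ℝ) ≠ 0 := by exact_mod_cast hN.ne'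
    field_simp
  have e1 : ∀ᶠ N : ℕ in atTop,
      Real.exp (L N (θ + η) - N * (η * (m + ε)) - L N θ) < 1 / 4 := by
    refine (tendsto_exp_zero_of_div_nat (l := Λ (θ + η) - η * (m + ε) - Λ θ) (by linarith)
      ?_).eventually_lt_const (by norm_num)
    simp_rw [sub_div]
    exact ((hΛ _ hηθ).sub (hlim _)).sub (hΛ _ hθ)
  have e2 : ∀ᶠ N : ℕ in atTop,
      Real.exp (L N (θ - η) + N * (η * (m - ε)) - L N θ) < 1 / 4 := by
    refine (tendsto_exp_zero_of_div_nat (l := Λ (θ - η) + η * (m - ε) - Λ θ) (by linarith)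
      ?_).eventually_lt_const (by norm_num)
    simp_rw [sub_div, add_div]
    exact ((hΛ _ (by linarith)).add (hlim _)).sub (hΛ _ hθ)
  have e3 : ∀ᶠ N : ℕ in atTop,
      Real.exp (-(N * r) - (L N θ - N * (θ * (m - ε)))) < 1 / 4 := by
    refine (tendsto_exp_zero_of_div_nat (l := -r - (Λ θ - θ * (m - ε))) (by linarith)
      ?_).eventually_lt_const (by norm_num)
    simp_rw [sub_div, neg_div]
    exact (hlim _).neg.sub ((hΛ _ hθ).sub (hlim _))
  have e4 : ∀ᶠ N : ℕ in atTop, N * (m + ε) < t N := by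
    filter_upwards [ht.eventually_const_lt hε1, eventually_gt_atTop 0] with N hN h0
    rw [lt_div_iff₀ (by exact_mod_cast h0)] at hN
    linarith
  filter_upwards [e1, e2, e3, e4] with N h1 h2 h3 h4
  have hA : MeasurableSet {x | D N x < t N} := measurableSet_lt (hD N) measurable_const
  -- Split at `N (m - ε)` and `t N`. Each outer part is dominated by a moment at `θ - η` or `θ + η`,
  -- and on the middle part `θ < 0` bounds the exponential by its value at `N (m - ε)`.
  have hpt : ∀ x, Real.exp (θ * D N x) ≤
      {x | D N x < t N}.indicator (fun _ => Real.exp (N * (θ * (m - ε)))) x +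
        Real.exp (-(N * (η * (m + ε)))) * Real.exp ((θ + η) * D N x) +
        Real.exp (N * (η * (m - ε))) * Real.exp ((θ - η) * D N x) := by
    intro x
    rw [← Real.exp_add, ← Real.exp_add]
    have p1 := Real.exp_pos (-(N * (η * (m + ε))) + (θ + η) * D N x)
    have p2 := Real.exp_pos (N * (η * (m - ε)) + (θ - η) * D N x)
    have p3 : 0 ≤ {x | D N x < t N}.indicator (fun _ => Real.exp (N * (θ * (m - ε)))) x :=
      Set.indicator_nonneg (fun _ _ => (Real.exp_pos _).le) x
    rcases lt_or_ge (D N x) (N * (m - ε)) with hx | hx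
    · have : Real.exp (θ * D N x) ≤ Real.exp (N * (η * (m - ε)) + (θ - η) * D N x) :=
        Real.exp_le_exp.2 (by nlinarith)
      linarith
    · rcases lt_or_ge (D N x) (t N) with hx' | hx'
      · rw [Set.indicator_of_mem (show x ∈ {x | D N x < t N} from hx')]
        have : Real.exp (θ * D N x) ≤ Real.exp (N * (θ * (m - ε))) :=
          Real.exp_le_exp.2 (by nlinarith)
        linarith
      · have : Real.exp (θ * D N x) ≤ Real.exp (-(N * (η * (m + ε))) + (θ + η) * D N x) :=
          Real.exp_le_exp.2 (by nlinarith)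
        linarith
  have i1 : Integrable ({x | D N x < t N}.indicator fun _ => Real.exp (N * (θ * (m - ε))))
      (μ N) := (integrable_const _).indicator hA
  have i2 := (hint N _ hηθ).const_mul (Real.exp (-(N * (η * (m + ε)))))
  have i3 := (hint N (θ - η) (by linarith)).const_mul (Real.exp (N * (η * (m - ε))))
  have hI := integral_mono (hint N θ hθ) ((i1.add i2).add i3) hpt
  rw [integral_add' (i1.add i2) i3, integral_add' i1 i2, integral_const_mul, integral_const_mul,
    hL N _ hθ, hL N _ hηθ, hL N _ (by linarith), integral_indicator_const _ hA, smul_eq_mul,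
    ← Real.exp_add, ← Real.exp_add] at hI
  set p := (μ N).real {x | D N x < t N}
  have k1 : Real.exp (-(N * (η * (m + ε))) + L N (θ + η)) ≤ 1 / 4 * Real.exp (L N θ) := by
    rw [show -(N * (η * (m + ε))) + L N (θ + η) =
      (L N (θ + η) - N * (η * (m + ε)) - L N θ) + L N θ by ring, Real.exp_add]
    gcongr
  have k2 : Real.exp (N * (η * (m - ε)) + L N (θ - η)) ≤ 1 / 4 * Real.exp (L N θ) := by
    rw [show N * (η * (m - ε)) + L N (θ - η) =
      (L N (θ - η) + N * (η * (m - ε)) - L N θ) + L N θ by ring, Real.exp_add]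
    gcongr
  -- The outer parts carry at most a quarter of the moment each, so the event carries at least half.
  have k3 : 1 / 2 * Real.exp (L N θ - N * (θ * (m - ε))) ≤ p := by
    rw [Real.exp_sub, ← mul_div_assoc, div_le_iff₀ (Real.exp_pos _)]
    linarith
  calc Real.exp (-(N * r))
      = Real.exp (-(N * r) - (L N θ - N * (θ * (m - ε)))) *
          Real.exp (L N θ - N * (θ * (m - ε))) := by rw [← Real.exp_add]; ring_nf
    _ ≤ 1 / 4 * Real.exp (L N θ - N * (θ * (m - ε))) := by gcongr
    _ ≤ p := by linarith [Real.exp_pos (L N θ - N * (θ * (m - ε)))]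

/-! ### Second moments and laws of large numbers -/

theorem map_fst_jointLaw (P : ℝ≥0) (W : Kernel ℝ 𝒴) [IsMarkovKernel W] :
    (jointLaw P W).map Prod.fst = gaussianReal 0 P :=
  Measure.fst_compProd _ _

theorem memLp_fst (P : ℝ≥0) (W : Kernel ℝ 𝒴) [IsMarkovKernel W] :
    MemLp (fun z : ℝ × 𝒴 => z.1) 2 (jointLaw P W) := by
  have h : MemLp id 2 ((jointLaw P W).map Prod.fst) := by
    rw [map_fst_jointLaw]
    exact memLp_id_gaussianReal' 2 (by norm_num)
  exact h.comp_of_map measurable_fst.aemeasurable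

theorem memLp_output {P : ℝ≥0} {W : Kernel ℝ 𝒴} {g : 𝒴 → ℝ} (hg : Measurable g)
    (hi : Integrable (fun z => g z.2 ^ 2) (jointLaw P W)) :
    MemLp (fun z : ℝ × 𝒴 => g z.2) 2 (jointLaw P W) :=
  (memLp_two_iff_integrable_sq (hg.comp measurable_snd).aestronglyMeasurable).2 hi

theorem integral_fst_sq (P : ℝ≥0) (W : Kernel ℝ 𝒴) [IsMarkovKernel W] :
    ∫ z, z.1 ^ 2 ∂(jointLaw P W) = P := by
  have h := variance_id_gaussianReal (μ := 0) (v := P)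
  rw [variance_eq_sub (memLp_id_gaussianReal' 2 (by norm_num))] at h
  simp only [integral_id_gaussianReal, id_eq, Pi.pow_apply] at h
  rw [← h, ← map_fst_jointLaw P W,
    integral_map measurable_fst.aemeasurable (by fun_prop)]
  simp

theorem integrable_sq_sub {P : ℝ≥0} {W : Kernel ℝ 𝒴} [IsMarkovKernel W] {g : 𝒴 → ℝ}
    (hg : Measurable g) (hi : Integrable (fun z => g z.2 ^ 2) (jointLaw P W)) (a : ℝ) :
    Integrable (fun z => (g z.2 - a * z.1) ^ 2) (jointLaw P W) :=
  ((memLp_output hg hi).sub ((memLp_fst P W).const_mul a)).integrable_sq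

theorem distortion_eq {P : ℝ≥0} {W : Kernel ℝ 𝒴} [IsMarkovKernel W] {g : 𝒴 → ℝ}
    (hg : Measurable g) (hi : Integrable (fun z => g z.2 ^ 2) (jointLaw P W)) (a : ℝ) :
    distortion P W g a = outPower P W g - 2 * a * corr P W g + a ^ 2 * P := by
  have hxg : Integrable (fun z => z.1 * g z.2) (jointLaw P W) :=
    (memLp_fst P W).integrable_mul (memLp_output hg hi)
  have h1 := hxg.const_mul (2 * a)
  have h2 := (memLp_fst P W).integrable_sq.const_mul (a ^ 2)
  rw [outPower, corr, ← integral_fst_sq P W, ← integral_const_mul, ← integral_const_mul,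
    ← integral_sub hi h1, ← integral_add (by exact hi.sub h1) h2, distortion]
  refine integral_congr_ae (ae_of_all _ fun z => ?_)
  ring

theorem outPower_nonneg (P : ℝ≥0) (W : Kernel ℝ 𝒴) (g : 𝒴 → ℝ) : 0 ≤ outPower P W g :=
  integral_nonneg fun _ => sq_nonneg _

theorem distortion_nonneg (P : ℝ≥0) (W : Kernel ℝ 𝒴) (g : 𝒴 → ℝ) (a : ℝ) :
    0 ≤ distortion P W g a :=
  integral_nonneg fun _ => sq_nonneg _

/-- The almost sure limit of the normalized cumulant, as a function of the output power `V`. -/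
noncomputable def limitCumulant (P : ℝ≥0) (V a θ : ℝ) : ℝ :=
  -(1 / 2) * Real.log (1 - 2 * θ * a ^ 2 * P) + θ * V / (1 - 2 * θ * a ^ 2 * P)

theorem tendsto_cumulant_div {𝒴 : Type*} (P : ℝ≥0) {g : 𝒴 → ℝ} (a θ : ℝ) {V : ℝ} {y : ℕ → 𝒴}
    (h : Tendsto (fun N : ℕ => (∑ n : Fin N, g (y n) ^ 2) / N) atTop (𝓝 V)) :
    Tendsto (fun N : ℕ => cumulant P g a (fun n : Fin N => y n) θ / N) atTop
      (𝓝 (limitCumulant P V a θ)) := by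
  refine ((tendsto_const_nhds (x := -(1 / 2) * Real.log (1 - 2 * θ * a ^ 2 * P))).add
    ((h.const_mul θ).div_const (1 - 2 * θ * a ^ 2 * P))).congr' ?_
  filter_upwards [eventually_gt_atTop 0] with N hN
  have : (N : ℝ) ≠ 0 := by exact_mod_cast hN.ne'
  rw [cumulant]
  field_simp

theorem ae_tendsto_logMGF {P : ℝ≥0} (hP : 0 < P) {W : Kernel ℝ 𝒴} [IsMarkovKernel W]
    {g : 𝒴 → ℝ} (hg : Measurable g) (hi : Integrable (fun z => g z.2 ^ 2) (jointLaw P W))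
    (a : ℝ) {θ : ℝ} (hθ : θ < 0) :
    ∀ᵐ y ∂(Measure.infinitePi fun _ : ℕ => outputLaw P W),
      Tendsto (fun N : ℕ => logMGF P g a θ y N / N) atTop
        (𝓝 (limitCumulant P (outPower P W g) a θ)) := by
  have hgm : AEStronglyMeasurable (fun y => g y ^ 2) ((jointLaw P W).map Prod.snd) :=
    (hg.pow_const 2).aestronglyMeasurable
  have hio : Integrable (fun y => g y ^ 2) (outputLaw P W) :=
    (integrable_map_measure hgm measurable_snd.aemeasurable).2 hi
  have hV : ∫ y, g y ^ 2 ∂(outputLaw P W) = outPower P W g :=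
    integral_map measurable_snd.aemeasurable hgm
  filter_upwards [ae_tendsto_average (outputLaw P W) (hg.pow_const 2) hio] with y hy
  rw [hV] at hy
  refine (tendsto_cumulant_div P a θ hy).congr fun N => ?_
  rw [logMGF, integral_exp_metric hP hθ.le, Real.log_exp]

theorem ae_tendsto_trueMetric {P : ℝ≥0} {W : Kernel ℝ 𝒴} [IsMarkovKernel W]
    {g : 𝒴 → ℝ} (hg : Measurable g) (hi : Integrable (fun z => g z.2 ^ 2) (jointLaw P W))
    (a : ℝ) :
    ∀ᵐ ω ∂(Measure.infinitePi fun _ : ℕ => jointLaw P W),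
      Tendsto (fun N : ℕ => trueMetric g a (fun n : Fin N => ω n) / N) atTop
        (𝓝 (distortion P W g a)) :=
  ae_tendsto_average (jointLaw P W) (f := fun z => (g z.2 - a * z.1) ^ 2) (by fun_prop)
    (integrable_sq_sub hg hi a)

theorem ae_tendsto_outPower {P : ℝ≥0} {W : Kernel ℝ 𝒴} [IsMarkovKernel W]
    {g : 𝒴 → ℝ} (hg : Measurable g) (hi : Integrable (fun z => g z.2 ^ 2) (jointLaw P W)) :
    ∀ᵐ ω ∂(Measure.infinitePi fun _ : ℕ => jointLaw P W),
      Tendsto (fun N : ℕ => (∑ n : Fin N, g (ω n).2 ^ 2) / N) atTop (𝓝 (outPower P W g)) :=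
  ae_tendsto_average (jointLaw P W) (f := fun z => g z.2 ^ 2) (by fun_prop) hi

/-! ### Achievable rates and rates that are not achievable -/

/-- Counting only the competitors matters for `R < 0`: the bound then tends to `0`, while the number
of messages never drops below `1`. -/
theorem natCast_numMessages_sub_one_le (N : ℕ) (R : ℝ) :
    ((numMessages N R - 1 : ℕ) : ℝ) ≤ Real.exp (N * R) := by
  have h1 : 1 ≤ numMessages N R := NeZero.one_le
  have h2 := Nat.ceil_lt_add_one (Real.exp_pos (N * R)).le
  rw [Nat.cast_sub h1, Nat.cast_one]
  exact (sub_lt_iff_lt_add.2 h2).le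

/-- Along almost every sequence the union and Chernoff bounds decay exponentially; truncation at `1`
permits dominated convergence. The value `θ = 0` is included because the optimal `γ` may be `0`. -/
theorem achievable_of_lt {dec : ∀ (M : ℕ) [NeZero M], (Fin M → ℝ) → Fin M}
    (hdec : IsArgminRule dec) {P : ℝ≥0} (hP : 0 < P) {W : Kernel ℝ 𝒴} [IsMarkovKernel W]
    {g : 𝒴 → ℝ} (hg : Measurable g) (hi : Integrable (fun z => g z.2 ^ 2) (jointLaw P W))
    {a θ R : ℝ} (hθ : θ ≤ 0)
    (hR : R < θ * distortion P W g a - limitCumulant P (outPower P W g) a θ) :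
    Achievable dec P W g a R := by
  have hdom : Tendsto (fun N : ℕ => ∫⁻ ω, min 1 (((numMessages N R - 1 : ℕ) : ℝ≥0∞) *
      leProb P g a (fun n : Fin N => ω n)) ∂(Measure.infinitePi fun _ : ℕ => jointLaw P W))
      atTop (𝓝 (∫⁻ _, 0 ∂(Measure.infinitePi fun _ : ℕ => jointLaw P W))) := by
    refine tendsto_lintegral_of_dominated_convergence (fun _ => 1) (fun N => ?_)
      (fun N => ae_of_all _ fun ω => min_le_left _ _) (by simp) ?_
    · exact measurable_const.min (((measurable_leProb P hg a N).comp
        (by fun_prop : Measurable fun (ω : ℕ → ℝ × 𝒴) (n : Fin N) => ω n)).const_mul _)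
    · filter_upwards [ae_tendsto_trueMetric hg hi a, ae_tendsto_outPower hg hi] with ω h1 h2
      have h3 := tendsto_cumulant_div P (g := g) a θ (y := fun n => (ω n).2) h2
      have h4 : Tendsto (fun N : ℕ => Real.exp (N * R + (cumulant P g a
          (fun n : Fin N => (ω n).2) θ - θ * trueMetric g a (fun n : Fin N => ω n))))
          atTop (𝓝 0) := by
        refine tendsto_exp_zero_of_div_nat (l := R + (limitCumulant P (outPower P W g) a θ -
          θ * distortion P W g a)) (by linarith) ?_
        refine (tendsto_const_nhds.add (h3.sub (h1.const_mul θ))).congr' ?_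
        filter_upwards [eventually_gt_atTop 0] with N hN
        have : (N : ℝ) ≠ 0 := by exact_mod_cast hN.ne'
        field_simp
      have h5 := ENNReal.tendsto_ofReal h4
      rw [ENNReal.ofReal_zero] at h5
      refine tendsto_of_tendsto_of_tendsto_of_le_of_le tendsto_const_nhds h5
        (fun _ => zero_le) fun N => (min_le_right _ _).trans ?_
      rw [Real.exp_add, ENNReal.ofReal_mul (Real.exp_pos _).le, leProb, ← ofReal_measureReal,
        ← ENNReal.ofReal_natCast]
      gcongr
      · exact natCast_numMessages_sub_one_le N R
      · exact measureReal_metric_le hP hθ a g _ _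
  rw [lintegral_zero] at hdom
  exact tendsto_of_tendsto_of_tendsto_of_le_of_le tendsto_const_nhds hdom (fun _ => zero_le)
    fun N => avgError_le hdec P W hg a N _

theorem hasDerivAt_limitCumulant (P : ℝ≥0) (V a : ℝ) {θ : ℝ}
    (hu : 1 - 2 * θ * a ^ 2 * P ≠ 0) :
    HasDerivAt (limitCumulant P V a)
      (V / (1 - 2 * θ * a ^ 2 * P) ^ 2 + a ^ 2 * P / (1 - 2 * θ * a ^ 2 * P)) θ := by
  have hlin : HasDerivAt (fun θ : ℝ => 1 - 2 * θ * a ^ 2 * P) (-(2 * a ^ 2 * P)) θ := by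
    have := (((hasDerivAt_id θ).const_mul 2).mul_const (a ^ 2)).mul_const (P : ℝ)
    exact (this.const_sub 1).congr_deriv (by ring)
  have h := ((hlin.log hu).const_mul (-(1 / 2))).add
    ((((hasDerivAt_id θ).mul_const V)).div hlin hu)
  refine h.congr_deriv ?_
  simp only [id_eq]
  field_simp
  ring

/-- Each competitor wins strictly with probability at least `exp (-N r)` for some `r < R`, and there
are about `exp (N R)` of them, so the probability that none wins tends to `0`. -/
theorem not_achievable_of_gt {dec : ∀ (M : ℕ) [NeZero M], (Fin M → ℝ) → Fin M}
    (hdec : IsArgminRule dec) {P : ℝ≥0} (hP : 0 < P) {W : Kernel ℝ 𝒴} [IsMarkovKernel W]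
    {g : 𝒴 → ℝ} (hg : Measurable g) (hi : Integrable (fun z => g z.2 ^ 2) (jointLaw P W))
    {a θ m R : ℝ} (hθ : θ < 0) (hm : HasDerivAt (limitCumulant P (outPower P W g) a) m θ)
    (hmd : m < distortion P W g a)
    (hR : θ * m - limitCumulant P (outPower P W g) a θ < R) :
    ¬ Achievable dec P W g a R := by
  intro hach
  obtain ⟨r, hr1, hr2⟩ := exists_between hR
  have hdom : Tendsto (fun N : ℕ => ∫⁻ ω, geProb P g a (fun n : Fin N => ω n) ^
      (numMessages N R - 1) ∂(Measure.infinitePi fun _ : ℕ => jointLaw P W))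
      atTop (𝓝 (∫⁻ _, 0 ∂(Measure.infinitePi fun _ : ℕ => jointLaw P W))) := by
    refine tendsto_lintegral_of_dominated_convergence (fun _ => 1) (fun N => ?_)
      (fun N => ae_of_all _ fun ω => pow_le_one₀ (zero_le) prob_le_one) (by simp) ?_
    · exact ((measurable_geProb P hg a N).comp
        (by fun_prop : Measurable fun (ω : ℕ → ℝ × 𝒴) (n : Fin N) => ω n)).pow_const _
    · filter_upwards [ae_tendsto_trueMetric hg hi a, ae_tendsto_outPower hg hi] with ω h1 h2
      have hld := eventually_exp_le_measureReal_lt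
        (fun N => Measure.pi fun _ : Fin N => gaussianReal 0 P)
        (D := fun N => metric g a (fun n : Fin N => (ω n).2))
        (fun N => measurable_metric_right g a _)
        (L := fun N θ => cumulant P g a (fun n : Fin N => (ω n).2) θ)
        (fun N θ hθ => integrable_exp_metric P hθ.le a g _)
        (fun N θ hθ => integral_exp_metric hP hθ.le a g _)
        (fun θ _ => tendsto_cumulant_div P (g := g) a θ (y := fun n => (ω n).2) h2)
        hθ hm hmd h1 hr1
      have hexp : Tendsto (fun N : ℕ => Real.exp (1 - Real.exp (N * (R - r)))) atTop (𝓝 0) := by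
        have ht : Tendsto (fun N : ℕ => (N : ℝ) * (R - r)) atTop atTop :=
          tendsto_natCast_atTop_atTop.atTop_mul_const (sub_pos.2 hr2)
        exact Real.tendsto_exp_atBot.comp
          (tendsto_atBot_add_const_left atTop 1
            (tendsto_neg_atTop_atBot.comp (Real.tendsto_exp_atTop.comp ht)))
      have h5 := ENNReal.tendsto_ofReal hexp
      rw [ENNReal.ofReal_zero] at h5
      refine tendsto_of_tendsto_of_tendsto_of_le_of_le' tendsto_const_nhds h5
        (Eventually.of_forall fun _ => zero_le) ?_
      filter_upwards [hld] with N hN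
      set z : Fin N → ℝ × 𝒴 := fun n => ω n with hz
      set p := (Measure.pi fun _ : Fin N => gaussianReal 0 P).real
        {x | metric g a (fun n => (z n).2) x < trueMetric g a z} with hp
      have hN' : Real.exp (-(N * r)) ≤ p := hN
      have hp1 : p ≤ 1 := measureReal_le_one
      have hge : geProb P g a z = ENNReal.ofReal (1 - p) := by
        rw [geProb, ← ofReal_measureReal, hp, ← probReal_compl_eq_one_sub
          (measurableSet_lt (measurable_metric_right g a _) measurable_const)]
        congr 2
        ext x
        simp
      have hM : Real.exp (N * R) ≤ ((numMessages N R - 1 : ℕ) : ℝ) + 1 := by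
        have h1 : 1 ≤ numMessages N R := NeZero.one_le
        rw [Nat.cast_sub h1, Nat.cast_one, sub_add_cancel]
        exact Nat.le_ceil _
      rw [hge, ← ENNReal.ofReal_pow (by linarith)]
      refine ENNReal.ofReal_le_ofReal ?_
      -- The exponent is one short of the number of messages; the missing factor costs `exp p ≤ exp
      -- 1`.
      calc (1 - p) ^ (numMessages N R - 1)
          ≤ Real.exp (-p) ^ (numMessages N R - 1) := by
            gcongr
            linarith [Real.add_one_le_exp (-p)]
        _ = Real.exp (p - p * (((numMessages N R - 1 : ℕ) : ℝ) + 1)) := by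
            rw [← Real.exp_nat_mul]; ring_nf
        _ ≤ Real.exp (1 - Real.exp (N * (R - r))) := by
            refine Real.exp_le_exp.2 (sub_le_sub hp1 ?_)
            rw [show N * (R - r) = -(N * r) + N * R by ring, Real.exp_add]
            gcongr
  rw [lintegral_zero] at hdom
  have hsum := hach.add hdom
  rw [add_zero] at hsum
  have := ge_of_tendsto' hsum fun N => one_le_avgError_add hdec P W hg a N _
  simp at this

/-- With the scaling parameter `0`, no positive rate is achievable. -/
theorem not_achievable_zero_scaling {dec : ∀ (M : ℕ) [NeZero M], (Fin M → ℝ) → Fin M}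
    (hdec : IsArgminRule dec) (P : ℝ≥0) (W : Kernel ℝ 𝒴) [IsMarkovKernel W]
    {g : 𝒴 → ℝ} (hg : Measurable g) {R : ℝ} (hR : 0 < R) : ¬ Achievable dec P W g 0 R := by
  intro hach
  have h : ∀ᶠ N : ℕ in atTop, (2 : ℝ≥0∞)⁻¹ ≤ avgError dec P W g 0 N (numMessages N R) := by
    filter_upwards [eventually_gt_atTop 0] with N hN
    -- Two messages suffice: the error `(M - 1) / M` is then at least `1 / 2`.
    have hM : 2 ≤ numMessages N R := by
      refine Nat.lt_ceil.2 ?_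
      rw [Nat.cast_one, Real.one_lt_exp_iff]
      have : (0 : ℝ) < N := by exact_mod_cast hN
      positivity
    rw [avgError_zero_scaling hdec P W hg]
    have h0 : ((numMessages N R : ℕ) : ℝ≥0∞) ≠ 0 := by exact_mod_cast NeZero.ne _
    rw [mul_comm, ← div_eq_mul_inv,
      ENNReal.le_div_iff_mul_le (Or.inl h0) (Or.inl (ENNReal.natCast_ne_top _)),
      ← ENNReal.mul_le_mul_iff_right (a := 2) (by simp) (by simp), ← mul_assoc,
      ENNReal.mul_inv_cancel (by simp) (by simp), one_mul]
    have : numMessages N R ≤ 2 * (numMessages N R - 1) := by omega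
    exact_mod_cast this
  have := ge_of_tendsto hach h
  simp at this

/-! ### Optimization over the parameter `γ = -2 θ a² P` -/

/-- The asymptotic mean of the normalized metric of an independent codeword under the tilted law
with parameter `γ`. -/
noncomputable def tiltedMean (P : ℝ≥0) (W : Kernel ℝ 𝒴) (g : 𝒴 → ℝ) (a γ : ℝ) : ℝ :=
  outPower P W g / (1 + γ) ^ 2 + a ^ 2 * P / (1 + γ)

/-- The first order conditions for a maximum of the objective at `γ` among `γ ≥ 0`. -/
structure IsOptimal (P : ℝ≥0) (W : Kernel ℝ 𝒴) (g : 𝒴 → ℝ) (a γ : ℝ) : Prop where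
  nonneg : 0 ≤ γ
  tiltedMean_le : tiltedMean P W g a γ ≤ distortion P W g a
  slack : γ * (distortion P W g a - tiltedMean P W g a γ) = 0

theorem continuousAt_tiltedMean (P : ℝ≥0) (W : Kernel ℝ 𝒴) (g : 𝒴 → ℝ) (a : ℝ) {γ : ℝ}
    (hγ : 0 ≤ γ) : ContinuousAt (tiltedMean P W g a) γ := by
  have h : 1 + γ ≠ 0 := by positivity
  have h2 : (1 + γ) ^ 2 ≠ 0 := by positivity
  unfold tiltedMean
  fun_prop (disch := assumption)

theorem continuousAt_objective (P : ℝ≥0) (W : Kernel ℝ 𝒴) (g : 𝒴 → ℝ) (a : ℝ) {γ : ℝ}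
    (hγ : 0 ≤ γ) : ContinuousAt (objective P W g a) γ := by
  have h : 1 + γ ≠ 0 := by positivity
  unfold objective
  fun_prop (disch := assumption)

/-- Gives the strict inequality `m < D` required by the converse once `γ` is moved slightly above
its optimal value. -/
theorem tiltedMean_lt_tiltedMean {P : ℝ≥0} (hP : 0 < P) (W : Kernel ℝ 𝒴) (g : 𝒴 → ℝ) {a : ℝ}
    (ha : a ≠ 0) {γ γ' : ℝ} (hγ : 0 ≤ γ) (h : γ < γ') :
    tiltedMean P W g a γ' < tiltedMean P W g a γ := by
  have hV := outPower_nonneg P W g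
  have hP' : (0 : ℝ) < P := hP
  have hs : 0 < a ^ 2 * P := by positivity
  unfold tiltedMean
  refine add_lt_add_of_le_of_lt ?_ ?_
  · gcongr
  · gcongr

theorem exists_isOptimal {P : ℝ≥0} (W : Kernel ℝ 𝒴) (g : 𝒴 → ℝ) (a : ℝ)
    (hd : distortion P W g a ≠ 0) : ∃ γ, IsOptimal P W g a γ := by
  have hd0 : 0 < distortion P W g a := (distortion_nonneg P W g a).lt_of_ne' hd
  have hV := outPower_nonneg P W g
  have hs : 0 ≤ a ^ 2 * P := by positivity
  rcases le_total (tiltedMean P W g a 0) (distortion P W g a) with h | h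
  · exact ⟨0, le_rfl, h, by simp⟩
  -- For `γ ≥ 0` the tilted mean is at most `(V + a² P) / (1 + γ)` with `V` the output power; this
  -- `B` brings that below the distortion, so the intermediate value theorem applies on `[0, B]`.
  · set B := (outPower P W g + a ^ 2 * P) / distortion P W g a with hB
    have hB0 : 0 ≤ B := by positivity
    have hBd : tiltedMean P W g a B ≤ distortion P W g a := by
      have h1 : outPower P W g / (1 + B) ^ 2 ≤ outPower P W g / (1 + B) := by
        gcongr
        nlinarith
      have h2 : (outPower P W g + a ^ 2 * P) / (1 + B) ≤ distortion P W g a := by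
        rw [div_le_iff₀ (by positivity), mul_add, hB, mul_div_cancel₀ _ hd]
        linarith
      rw [add_div] at h2
      exact (add_le_add_left h1 _).trans h2
    obtain ⟨γ, hγ, he⟩ := intermediate_value_Icc' hB0
      (fun γ hγ => (continuousAt_tiltedMean P W g a hγ.1).continuousWithinAt) ⟨hBd, h⟩
    exact ⟨γ, hγ.1, he.le, by rw [he]; ring⟩

theorem objective_eq {P : ℝ≥0} (hP : 0 < P) {W : Kernel ℝ 𝒴} [IsMarkovKernel W] {g : 𝒴 → ℝ}
    (hg : Measurable g) (hi : Integrable (fun z => g z.2 ^ 2) (jointLaw P W)) {a : ℝ}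
    (ha : a ≠ 0) {γ : ℝ} (hγ : 0 ≤ γ) :
    objective P W g a γ = -γ / (2 * a ^ 2 * P) * distortion P W g a -
      limitCumulant P (outPower P W g) a (-γ / (2 * a ^ 2 * P)) := by
  have hP' : (P : ℝ) ≠ 0 := by exact_mod_cast hP.ne'
  have hu : 1 - 2 * (-γ / (2 * a ^ 2 * P)) * a ^ 2 * P = 1 + γ := by field_simp; ring
  have h1 : 1 + γ ≠ 0 := by positivity
  rw [limitCumulant, hu, distortion_eq hg hi, objective]
  field_simp
  ring

theorem IsOptimal.objective_le {P : ℝ≥0} (hP : 0 < P) {W : Kernel ℝ 𝒴} [IsMarkovKernel W]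
    {g : 𝒴 → ℝ} (hg : Measurable g) (hi : Integrable (fun z => g z.2 ^ 2) (jointLaw P W)) {a : ℝ}
    (ha : a ≠ 0) {γ₀ : ℝ} (h : IsOptimal P W g a γ₀) {γ : ℝ} (hγ : 0 ≤ γ) :
    objective P W g a γ ≤ objective P W g a γ₀ := by
  have hP' : (0 : ℝ) < P := hP
  have hV := outPower_nonneg P W g
  obtain ⟨h0, hle, hsl⟩ := h
  have hu0 : 0 < 1 + γ₀ := by linarith
  have hu : 0 < 1 + γ := by linarith
  have hlog : Real.log (1 + γ) - Real.log (1 + γ₀) ≤ (1 + γ) / (1 + γ₀) - 1 := by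
    rw [← Real.log_div hu.ne' hu0.ne']
    exact Real.log_le_sub_one_of_pos (by positivity)
  -- Concavity made explicit: the linear term at `γ₀`, plus the tangent-line errors of `log (1 + γ)`
  -- and of `γ² / (1 + γ) = γ - 1 + 1 / (1 + γ)`.
  have key : objective P W g a γ - objective P W g a γ₀ =
      1 / 2 * (Real.log (1 + γ) - Real.log (1 + γ₀) - ((1 + γ) / (1 + γ₀) - 1)) +
      (-(γ * (distortion P W g a - tiltedMean P W g a γ₀)) +
        γ₀ * (distortion P W g a - tiltedMean P W g a γ₀)) / (2 * a ^ 2 * P) -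
      outPower P W g / (2 * a ^ 2 * P) * ((γ - γ₀) ^ 2 / ((1 + γ) * (1 + γ₀) ^ 2)) := by
    rw [distortion_eq hg hi, tiltedMean, objective, objective]
    field_simp
    ring
  have t1 : 0 ≤ γ * (distortion P W g a - tiltedMean P W g a γ₀) :=
    mul_nonneg hγ (sub_nonneg.2 hle)
  have t2 : (-(γ * (distortion P W g a - tiltedMean P W g a γ₀)) +
        γ₀ * (distortion P W g a - tiltedMean P W g a γ₀)) / (2 * a ^ 2 * P) ≤ 0 :=
    div_nonpos_of_nonpos_of_nonneg (by linarith) (by positivity)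
  have t3 : 0 ≤ outPower P W g / (2 * a ^ 2 * P) * ((γ - γ₀) ^ 2 / ((1 + γ) * (1 + γ₀) ^ 2)) := by
    positivity
  linarith

theorem isGMI_of_isLUB {P : ℝ≥0} (hP : 0 < P) {W : Kernel ℝ 𝒴} [IsMarkovKernel W]
    {g : 𝒴 → ℝ} (hg : Measurable g) (hi : Integrable (fun z => g z.2 ^ 2) (jointLaw P W))
    {A : Set ℝ} {I : ℝ}
    (h : IsLUB {v | ∃ a ∈ A, ∃ θ < 0, v = θ * distortion P W g a -
      limitCumulant P (outPower P W g) a θ} I) : IsGMI P W g A I :=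
  ⟨limitCumulant P (outPower P W g), fun a _ _ hθ => ae_tendsto_logMGF hP hg hi a hθ, h⟩

theorem IsOptimal.isGreatest {P : ℝ≥0} (hP : 0 < P) {W : Kernel ℝ 𝒴} [IsMarkovKernel W]
    {g : 𝒴 → ℝ} (hg : Measurable g) (hi : Integrable (fun z => g z.2 ^ 2) (jointLaw P W)) {a : ℝ}
    (ha : a ≠ 0) {γ₀ : ℝ} (h : IsOptimal P W g a γ₀) :
    IsGreatest (objective P W g a '' Set.Ici 0) (objective P W g a γ₀) :=
  ⟨⟨γ₀, h.nonneg, rfl⟩, by rintro _ ⟨γ, hγ, rfl⟩; exact h.objective_le hP hg hi ha hγ⟩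

theorem objective_of_neg {P : ℝ≥0} (hP : 0 < P) {W : Kernel ℝ 𝒴} [IsMarkovKernel W]
    {g : 𝒴 → ℝ} (hg : Measurable g) (hi : Integrable (fun z => g z.2 ^ 2) (jointLaw P W)) {a : ℝ}
    (ha : a ≠ 0) {θ : ℝ} (hθ : θ < 0) :
    θ * distortion P W g a - limitCumulant P (outPower P W g) a θ =
      objective P W g a (-θ * (2 * a ^ 2 * P)) := by
  have hP' : (0 : ℝ) < P := hP
  have hθ' : 0 < -θ := neg_pos.2 hθ
  rw [objective_eq hP hg hi ha (by positivity),
    show -(-θ * (2 * a ^ 2 * P)) / (2 * a ^ 2 * P) = θ by field_simp]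

theorem IsOptimal.isLUB {P : ℝ≥0} (hP : 0 < P) {W : Kernel ℝ 𝒴} [IsMarkovKernel W]
    {g : 𝒴 → ℝ} (hg : Measurable g) (hi : Integrable (fun z => g z.2 ^ 2) (jointLaw P W)) {a : ℝ}
    (ha : a ≠ 0) {γ₀ : ℝ} (h : IsOptimal P W g a γ₀) :
    IsLUB {v | ∃ a' ∈ ({a} : Set ℝ), ∃ θ < 0, v = θ * distortion P W g a' -
      limitCumulant P (outPower P W g) a' θ} (objective P W g a γ₀) := by
  have hP' : (0 : ℝ) < P := hP
  constructor
  · rintro _ ⟨_, rfl, θ, hθ, rfl⟩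
    have hθ' : 0 < -θ := neg_pos.2 hθ
    rw [objective_of_neg hP hg hi ha hθ]
    exact h.objective_le hP hg hi ha (by positivity)
  · intro b hb
    -- For `γ₀ = 0` the supremum over `θ < 0` need not be attained, so it is approached through `γ ↓
    -- γ₀`.
    refine le_of_tendsto
      ((continuousAt_objective P W g a h.nonneg).continuousWithinAt (s := Set.Ioi γ₀)) ?_
    filter_upwards [self_mem_nhdsWithin] with γ hγ
    have hγ0 : 0 < γ := h.nonneg.trans_lt hγ
    exact hb ⟨a, rfl, -γ / (2 * a ^ 2 * P),
      div_neg_of_neg_of_pos (neg_neg_of_pos hγ0) (by positivity),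
      objective_eq hP hg hi ha hγ0.le⟩

theorem IsOptimal.isMaxRate {P : ℝ≥0} (hP : 0 < P) {W : Kernel ℝ 𝒴} [IsMarkovKernel W]
    {g : 𝒴 → ℝ} (hg : Measurable g) (hi : Integrable (fun z => g z.2 ^ 2) (jointLaw P W)) {a : ℝ}
    (ha : a ≠ 0) {γ₀ : ℝ} (h : IsOptimal P W g a γ₀) :
    IsMaxRate P W g a (objective P W g a γ₀) := by
  have hP' : (0 : ℝ) < P := hP
  intro dec hdec
  constructor
  · intro R hR
    rw [objective_eq hP hg hi ha h.nonneg] at hR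
    exact achievable_of_lt hdec hP hg hi
      (div_nonpos_of_nonpos_of_nonneg (neg_nonpos.2 h.nonneg) (by positivity)) hR
  · intro R hR
    -- This is the converse exponent `θ m - Λ θ` in terms of `γ`. Complementary slackness makes it
    -- equal the objective at `γ₀`, and continuity keeps it below `R` just to the right.
    let F : ℝ → ℝ := fun γ => objective P W g a γ +
      γ / (2 * a ^ 2 * P) * (distortion P W g a - tiltedMean P W g a γ)
    have hF0 : F γ₀ = objective P W g a γ₀ := by
      simp only [F]
      rw [div_mul_eq_mul_div, h.slack, zero_div, add_zero]
    have hF : ContinuousAt F γ₀ :=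
      (continuousAt_objective P W g a h.nonneg).add
        ((continuousAt_id.div_const _).mul
          (continuousAt_const.sub (continuousAt_tiltedMean P W g a h.nonneg)))
    have hev : ∀ᶠ γ in 𝓝[>] γ₀, F γ < R :=
      (hF.continuousWithinAt (s := Set.Ioi γ₀)).eventually_lt_const (by rwa [hF0])
    obtain ⟨γ, hγR, hγ⟩ := (hev.and self_mem_nhdsWithin).exists
    have hγ0 : 0 < γ := h.nonneg.trans_lt hγ
    have hu : 1 - 2 * (-γ / (2 * a ^ 2 * P)) * a ^ 2 * P = 1 + γ := by field_simp; ring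
    have hder := hasDerivAt_limitCumulant P (outPower P W g) a (θ := -γ / (2 * a ^ 2 * P))
      (by rw [hu]; positivity)
    rw [hu] at hder
    refine not_achievable_of_gt hdec hP hg hi
      (div_neg_of_neg_of_pos (neg_neg_of_pos hγ0) (by positivity)) hder
      ((tiltedMean_lt_tiltedMean hP W g ha h.nonneg hγ).trans_le h.tiltedMean_le) ?_
    refine lt_of_eq_of_lt ?_ hγR
    simp only [F]
    rw [objective_eq hP hg hi ha hγ0.le, tiltedMean]
    ring

/-! ### The optimal scaling parameter -/

/-- This scaling is the least squares coefficient of `g(y)` on `x`, and the right-hand side is the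
residual power. Its nonnegativity yields `Delta ≤ 1`. -/
theorem distortion_corr_div {P : ℝ≥0} (hP : 0 < P) {W : Kernel ℝ 𝒴} [IsMarkovKernel W]
    {g : 𝒴 → ℝ} (hg : Measurable g) (hi : Integrable (fun z => g z.2 ^ 2) (jointLaw P W))
    (hV : outPower P W g ≠ 0) :
    distortion P W g (corr P W g / P) = outPower P W g * (1 - Delta P W g) := by
  have hP' : (P : ℝ) ≠ 0 := by exact_mod_cast hP.ne'
  rw [distortion_eq hg hi, Delta]
  field_simp
  ring

theorem one_sub_Delta_pos {P : ℝ≥0} (hP : 0 < P) {W : Kernel ℝ 𝒴} [IsMarkovKernel W]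
    {g : 𝒴 → ℝ} (hg : Measurable g) (hi : Integrable (fun z => g z.2 ^ 2) (jointLaw P W))
    (hV : outPower P W g ≠ 0) (hΔ : Delta P W g ≠ 1) : 0 < 1 - Delta P W g := by
  have hV0 : 0 < outPower P W g := (outPower_nonneg P W g).lt_of_ne' hV
  have h := distortion_nonneg P W g (corr P W g / P)
  rw [distortion_corr_div hP hg hi hV] at h
  exact (nonneg_of_mul_nonneg_right h hV0).lt_of_ne' (sub_ne_zero.2 hΔ.symm)

theorem isOptimal_corr_div {P : ℝ≥0} (hP : 0 < P) {W : Kernel ℝ 𝒴} [IsMarkovKernel W]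
    {g : 𝒴 → ℝ} (hg : Measurable g) (hi : Integrable (fun z => g z.2 ^ 2) (jointLaw P W))
    (hV : outPower P W g ≠ 0) (hΔ : Delta P W g ≠ 1) :
    IsOptimal P W g (corr P W g / P) (Delta P W g / (1 - Delta P W g)) := by
  have hP' : (0 : ℝ) < P := hP
  have hV0 := outPower_nonneg P W g
  have h1 := one_sub_Delta_pos hP hg hi hV hΔ
  have hC : corr P W g ^ 2 = Delta P W g * (P * outPower P W g) := by
    rw [Delta]; field_simp
  have hu : 1 + Delta P W g / (1 - Delta P W g) = 1 / (1 - Delta P W g) := by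
    field_simp; ring
  have he : tiltedMean P W g (corr P W g / P) (Delta P W g / (1 - Delta P W g)) =
      distortion P W g (corr P W g / P) := by
    rw [tiltedMean, hu, distortion_corr_div hP hg hi hV, div_pow (corr P W g), hC]
    field_simp
    ring
  refine ⟨div_nonneg ?_ h1.le, he.le, by rw [he]; ring⟩
  unfold Delta
  positivity

theorem objective_corr_div {P : ℝ≥0} (hP : 0 < P) {W : Kernel ℝ 𝒴} [IsMarkovKernel W]
    {g : 𝒴 → ℝ} (hg : Measurable g) (hi : Integrable (fun z => g z.2 ^ 2) (jointLaw P W))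
    (hV : outPower P W g ≠ 0) (hΔ : Delta P W g ≠ 1) (hC : corr P W g ≠ 0) :
    objective P W g (corr P W g / P) (Delta P W g / (1 - Delta P W g)) =
      1 / 2 * Real.log (1 / (1 - Delta P W g)) := by
  have hP' : (0 : ℝ) < P := hP
  have h1 := one_sub_Delta_pos hP hg hi hV hΔ
  have hCsq : corr P W g ^ 2 = Delta P W g * (P * outPower P W g) := by
    rw [Delta]; field_simp
  have hΔ0 : Delta P W g ≠ 0 := by
    intro h
    rw [h, zero_mul] at hCsq
    exact hC (pow_eq_zero_iff two_ne_zero |>.1 hCsq)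
  have hu : 1 + Delta P W g / (1 - Delta P W g) = 1 / (1 - Delta P W g) := by
    field_simp; ring
  rw [objective, hu, div_pow (corr P W g), hCsq]
  field_simp
  ring

/-- No scaling parameter and no `γ` beat the optimal pair. -/
theorem rate_le_of_neg {P : ℝ≥0} (hP : 0 < P) {W : Kernel ℝ 𝒴} [IsMarkovKernel W]
    {g : 𝒴 → ℝ} (hg : Measurable g) (hi : Integrable (fun z => g z.2 ^ 2) (jointLaw P W))
    (hV : outPower P W g ≠ 0) (hΔ : Delta P W g ≠ 1) (a : ℝ) {θ : ℝ} (hθ : θ < 0) :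
    θ * distortion P W g a - limitCumulant P (outPower P W g) a θ ≤
      1 / 2 * Real.log (1 / (1 - Delta P W g)) := by
  have hP' : (0 : ℝ) < P := hP
  have hV0 : 0 < outPower P W g := (outPower_nonneg P W g).lt_of_ne' hV
  have h1 := one_sub_Delta_pos hP hg hi hV hΔ
  set u := 1 - 2 * θ * a ^ 2 * P with hu
  have hu0 : 0 < u := by
    have : 0 ≤ -θ * (a ^ 2 * P) := mul_nonneg (neg_nonneg.2 hθ.le) (by positivity)
    nlinarith
  have hlog := Real.log_le_sub_one_of_pos (mul_pos hu0 h1)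
  rw [Real.log_mul hu0.ne' h1.ne'] at hlog
  -- After `log x ≤ x - 1` at `x = u (1 - Δ)`, the gap to the claimed rate is at most this
  -- expression, minus a perfect square over a positive number.
  have key : θ * distortion P W g a - θ * outPower P W g / u + 1 / 2 * (u * (1 - Delta P W g) - 1)
      = -((corr P W g * u + 2 * θ * a * P * outPower P W g) ^ 2 /
        (2 * P * outPower P W g * u)) := by
    rw [distortion_eq hg hi, Delta]
    field_simp
    rw [hu]
    ring
  have hsq : 0 ≤ (corr P W g * u + 2 * θ * a * P * outPower P W g) ^ 2 /
      (2 * P * outPower P W g * u) := by positivity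
  rw [limitCumulant, ← hu, one_div (1 - Delta P W g), Real.log_inv]
  linarith

theorem isLUB_corr_div {P : ℝ≥0} (hP : 0 < P) {W : Kernel ℝ 𝒴} [IsMarkovKernel W]
    {g : 𝒴 → ℝ} (hg : Measurable g) (hi : Integrable (fun z => g z.2 ^ 2) (jointLaw P W))
    (hV : outPower P W g ≠ 0) (hΔ : Delta P W g ≠ 1) :
    IsLUB {v | ∃ a ∈ ({corr P W g / P} : Set ℝ), ∃ θ < 0, v = θ * distortion P W g a -
      limitCumulant P (outPower P W g) a θ} (1 / 2 * Real.log (1 / (1 - Delta P W g))) := by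
  -- When the scaling is `0` the substitution `γ = -2 θ a² P` degenerates, but every `θ < 0` gives
  -- the value `0`, which is the claimed rate.
  by_cases hC : corr P W g = 0
  · refine ⟨?_, fun b hb => ?_⟩
    · rintro _ ⟨a, -, θ, hθ, rfl⟩
      exact rate_le_of_neg hP hg hi hV hΔ a hθ
    · refine hb ⟨0, by simp [hC], -1, by norm_num, ?_⟩
      rw [distortion_eq hg hi, limitCumulant]
      simp [Delta, hC]
  · have ha : corr P W g / P ≠ 0 := div_ne_zero hC (by exact_mod_cast hP.ne')
    rw [← objective_corr_div hP hg hi hV hΔ hC]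
    exact (isOptimal_corr_div hP hg hi hV hΔ).isLUB hP hg hi ha

theorem isLUB_univ {P : ℝ≥0} (hP : 0 < P) {W : Kernel ℝ 𝒴} [IsMarkovKernel W]
    {g : 𝒴 → ℝ} (hg : Measurable g) (hi : Integrable (fun z => g z.2 ^ 2) (jointLaw P W))
    (hV : outPower P W g ≠ 0) (hΔ : Delta P W g ≠ 1) :
    IsLUB {v | ∃ a ∈ (Set.univ : Set ℝ), ∃ θ < 0, v = θ * distortion P W g a -
      limitCumulant P (outPower P W g) a θ} (1 / 2 * Real.log (1 / (1 - Delta P W g))) := by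
  refine ⟨?_, fun b hb => (isLUB_corr_div hP hg hi hV hΔ).2 ?_⟩
  · rintro _ ⟨a, -, θ, hθ, rfl⟩
    exact rate_le_of_neg hP hg hi hV hΔ a hθ
  · rintro v ⟨a, -, θ, hθ, h⟩
    exact hb ⟨a, Set.mem_univ a, θ, hθ, h⟩

theorem isMaxRate_corr_div {P : ℝ≥0} (hP : 0 < P) {W : Kernel ℝ 𝒴} [IsMarkovKernel W]
    {g : 𝒴 → ℝ} (hg : Measurable g) (hi : Integrable (fun z => g z.2 ^ 2) (jointLaw P W))
    (hV : outPower P W g ≠ 0) (hΔ : Delta P W g ≠ 1) :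
    IsMaxRate P W g (corr P W g / P) (1 / 2 * Real.log (1 / (1 - Delta P W g))) := by
  by_cases hC : corr P W g = 0
  · have h0 : 1 / 2 * Real.log (1 / (1 - Delta P W g)) = 0 := by simp [Delta, hC]
    rw [h0, hC, zero_div]
    intro dec hdec
    -- Here `θ = 0`: only negative rates remain to be achieved.
    refine ⟨fun R hR => achievable_of_lt hdec hP hg hi le_rfl ?_,
      fun R hR => not_achievable_zero_scaling hdec P W hg hR⟩
    simpa [limitCumulant] using hR
  · have ha : corr P W g / P ≠ 0 := div_ne_zero hC (by exact_mod_cast hP.ne')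
    rw [← objective_corr_div hP hg hi hV hΔ hC]
    exact (isOptimal_corr_div hP hg hi hV hΔ).isMaxRate hP hg hi ha

end GMI

/-- The generalized mutual information of a memoryless channel `W` under the i.i.d. Gaussian
ensemble and nearest neighbor decoding, given a training data set `T` of `L` input-output pairs,
when `(g, a)` is learnt by `learnA`, and when only `g` is learnt, by `learnB`, and the optimal
scaling parameter `a = E[x g(y)] / P` is used. -/
theorem mainTheorem4 {𝒴 : Type*} [MeasurableSpace 𝒴] (P : ℝ≥0) (hP : 0 < P)
    (W : Kernel ℝ 𝒴) [IsMarkovKernel W]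
    (L : ℕ) (T : Fin L → ℝ × 𝒴)
    (learnA : (Fin L → ℝ × 𝒴) → (𝒴 → ℝ) × ℝ) (learnB : (Fin L → ℝ × 𝒴) → (𝒴 → ℝ)) :
    -- scenario (A)
    (∀ (gT : 𝒴 → ℝ) (aT : ℝ), learnA T = (gT, aT) →
      Measurable gT → Integrable (fun z => gT z.2 ^ 2) (GMI.jointLaw P W) →
      aT ≠ 0 → GMI.distortion P W gT aT ≠ 0 →
      ∃ I : ℝ, IsGreatest (GMI.objective P W gT aT '' Set.Ici 0) I ∧
        GMI.IsGMI P W gT {aT} I ∧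
        GMI.IsMaxRate P W gT aT I) ∧
    -- scenario (B)
    (∀ gT : 𝒴 → ℝ, learnB T = gT →
      Measurable gT → Integrable (fun z => gT z.2 ^ 2) (GMI.jointLaw P W) →
      GMI.outPower P W gT ≠ 0 → GMI.Delta P W gT ≠ 1 →
      GMI.IsGMI P W gT Set.univ (1 / 2 * Real.log (1 / (1 - GMI.Delta P W gT))) ∧
      GMI.IsGMI P W gT {GMI.corr P W gT / P}
        (1 / 2 * Real.log (1 / (1 - GMI.Delta P W gT))) ∧
      GMI.IsMaxRate P W gT (GMI.corr P W gT / P)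
        (1 / 2 * Real.log (1 / (1 - GMI.Delta P W gT)))) := by
  refine ⟨fun g a _ hg hi ha hd => ?_, fun g _ hg hi hV hΔ => ⟨?_, ?_, ?_⟩⟩
  · obtain ⟨γ, hγ⟩ := GMI.exists_isOptimal W g a hd
    exact ⟨_, hγ.isGreatest hP hg hi ha,
      GMI.isGMI_of_isLUB hP hg hi (hγ.isLUB hP hg hi ha), hγ.isMaxRate hP hg hi ha⟩
  · exact GMI.isGMI_of_isLUB hP hg hi (GMI.isLUB_univ hP hg hi hV hΔ)
  · exact GMI.isGMI_of_isLUB hP hg hi (GMI.isLUB_corr_div hP hg hi hV hΔ)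
  · exact GMI.isMaxRate_corr_div hP hg hi hV hΔ
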